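/- Let $G$ be a finite triangulated planar graph, let $\Gamma_1$ be a straight-line planar drawing of $G$ in which every face, including the outer one, is bounded by a triangle of $G$, and let $\Gamma_2$ be another drawing of $G$. A *linear morph* from a drawing $\Gamma$ to a drawing $\Gamma'$ of the same graph moves each vertex at constant speed along a straight line from its position in $\Gamma$ to its position in $\Gamma'$. It is *planar* if at every time $t\in[0,1]$ the vertices are distinct, no vertex lies on an edge of which it is not an endpoint, and no two edges cross (edges being straight segments). It is *unidirectional* if there is a unit vector $\ell$ such that each vertex $v$ moves from its position $v_0$ to $v_0+c_v\ell$ for some $c_v\in\mathbb R$. A *pseudo-morph* between two drawings of a graph is a finite sequence of the following: (i) linear morphs; (ii) a contraction of a vertex $p$ to a neighbour $a$, followed by a pseudo-morph between two drawings of the reduced graph (in which $p$ is deleted and its neighbours other than $a$ are joined to $a$), and then the uncontraction of $p$. The number of steps is the number of linear morphs plus the number of contractions and uncontractions, those of nested pseudo-morphs included. A contraction step in a drawing is *planar* if $p$ is not on the boundary of the outer face, the drawing remains planar while $p$ moves along the segment $pa$ until it reaches $a$, and the resulting drawing of the reduced graph is planar; an uncontraction is planar if its time reversal is a planar contraction.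 Contractions and uncontractions are unidirectional, as only one vertex moves. **Lemma.** Let $\mathcal M$ be a pseudo-morph from $\Gamma_1$ to $\Gamma_2$ that consists of $k$ planar unidirectional steps, and suppose that every vertex contracted in $\mathcal M$ has degree at most $5$ in the graph in which it is contracted. Then there are straight-line planar drawings $\Gamma_1=\Delta_0,\Delta_1,\dots,\Delta_k=\Gamma_2$ of $G$ such that, for each $0\le i<k$, the linear morph from $\Delta_i$ to $\Delta_{i+1}$ is planar and unidirectional. That is, there is a planar morph from $\Gamma_1$ to $\Gamma_2$ consisting of $k$ unidirectional steps. -/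

import Mathlib

namespace PlanarMorph

universe u

/-- The Euclidean plane. -/
abbrev Plane : Type := EuclideanSpace ℝ (Fin 2)

section Drawings

variable {V : Type u}

/-- Placing the vertices of `G` at the points `f v` and drawing every edge as a straight segment
gives a planar drawing: vertices are at distinct points, no vertex lies on an edge of which it is
not an endpoint, and two distinct edges do not cross. -/
structure IsPlanarDrawing (G : SimpleGraph V) (f : V → Plane) : Prop where
  injective : Function.Injective f
  vertex_edge : ∀ u v w : V, G.Adj u v → w ≠ u → w ≠ v → f w ∉ segment ℝ (f u) (f v)
  edge_edge : ∀ u v x y : V, G.Adj u v → G.Adj x y → s(u, v) ≠ s(x, y) →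
    Disjoint (openSegment ℝ (f u) (f v)) (openSegment ℝ (f x) (f y))

/-- The point set covered by the vertices and edges of the drawing. -/
def drawnSet (G : SimpleGraph V) (f : V → Plane) : Set Plane :=
  {x | (∃ v, x = f v) ∨ ∃ u v, G.Adj u v ∧ x ∈ segment ℝ (f u) (f v)}

/-- The faces of the drawing: the connected components of the complement of the drawn set
(the unbounded one is the outer face). -/
def IsFace (G : SimpleGraph V) (f : V → Plane) (F : Set Plane) : Prop :=
  ∃ x ∈ (drawnSet G f)ᶜ, F = connectedComponentIn (drawnSet G f)ᶜ x

/-- A straight-line planar drawing of a triangulated graph: every face, the outer face included,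
is bounded by a triangle of the graph. -/
structure IsTriangulated (G : SimpleGraph V) (f : V → Plane) : Prop where
  planar : IsPlanarDrawing G f
  faces : ∀ F, IsFace G f F → ∃ u v w : V, G.Adj u v ∧ G.Adj v w ∧ G.Adj w u ∧
    frontier F = segment ℝ (f u) (f v) ∪ segment ℝ (f v) (f w) ∪ segment ℝ (f w) (f u)

/-- `v` is a boundary vertex of the drawing: it lies on the boundary of the outer face. -/
def IsBoundaryVertex (G : SimpleGraph V) (f : V → Plane) (v : V) : Prop :=
  ∃ F, IsFace G f F ∧ ¬ Bornology.IsBounded F ∧ f v ∈ frontier F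

/-- The linear morph from `f` to `g` at time `t`: every vertex moves at constant speed along a
straight line. -/
noncomputable def linearMorph (f g : V → Plane) (t : ℝ) : V → Plane :=
  fun v => AffineMap.lineMap (f v) (g v) t

/-- The linear morph from `f` to `g` is planar: it is a planar drawing at all times. -/
def IsPlanarStep (G : SimpleGraph V) (f g : V → Plane) : Prop :=
  ∀ t ∈ Set.Icc (0 : ℝ) 1, IsPlanarDrawing G (linearMorph f g t)

/-- The linear morph from `f` to `g` is unidirectional: all vertices move parallel to one line. -/
def IsUnidirectionalStep (f g : V → Plane) : Prop :=
  ∃ l : Plane, ‖l‖ = 1 ∧ ∀ v, ∃ c : ℝ, g v = f v + c • l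

/-- The graph obtained from `G` by contracting `p` to `a`: the vertex `p` disappears and its
neighbours (other than `a`) become neighbours of `a`. -/
def contractGraph (G : SimpleGraph V) (p a : V) : SimpleGraph {v : V // v ≠ p} :=
  SimpleGraph.fromRel fun u v => G.Adj u.1 v.1 ∨ (u.1 = a ∧ G.Adj p v.1)

/-- The drawing of the reduced graph obtained by forgetting the position of `p`. -/
def reduce (f : V → Plane) (p : V) : {v : V // v ≠ p} → Plane :=
  fun v => f v.1

open Classical in
/-- In the drawing `f`, the contraction of `p` to `a` is a planar step: `p` is a non-boundary
vertex, the drawing of `G` stays planar while `p` moves along the edge `pa` until it reaches `a`,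
and when it arrives the resulting drawing of the reduced graph is planar. Run backwards, this says
that the uncontraction of `p` from `a` with result `f` is a planar step. -/
structure IsPlanarContraction (G : SimpleGraph V) (f : V → Plane) (p a : V) : Prop where
  nonboundary : ¬ IsBoundaryVertex G f p
  before : ∀ t ∈ Set.Ico (0 : ℝ) 1,
    IsPlanarDrawing G (linearMorph f (Function.update f p (f a)) t)
  after : IsPlanarDrawing (contractGraph G p a) (reduce f p)

end Drawings

/-- A pseudo-morph from the drawing `f` to the drawing `h` of a graph is a finite sequence of
* linear morphs, and
* contractions of a vertex `p` to a neighbour `a`, followed by a pseudo-morph between two drawings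
  of the reduced graph and by the uncontraction of `p`. -/
inductive PseudoMorph : {V : Type u} → SimpleGraph V → (V → Plane) → (V → Plane) → Type (u + 1)
  | nil {V : Type u} (G : SimpleGraph V) (f : V → Plane) : PseudoMorph G f f
  | linear {V : Type u} {G : SimpleGraph V} (f g h : V → Plane)
      (rest : PseudoMorph G g h) : PseudoMorph G f h
  | contract {V : Type u} {G : SimpleGraph V} (f g h : V → Plane) (p a : V) (hpa : G.Adj p a)
      (inner : PseudoMorph (contractGraph G p a) (reduce f p) (reduce g p))
      (rest : PseudoMorph G g h) : PseudoMorph G f h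

namespace PseudoMorph

/-- The number of steps: linear morphs plus contractions plus uncontractions. -/
def numSteps : {V : Type u} → {G : SimpleGraph V} → {f h : V → Plane} → PseudoMorph G f h → ℕ
  | _, _, _, _, nil _ _ => 0
  | _, _, _, _, linear _ _ _ rest => 1 + rest.numSteps
  | _, _, _, _, contract _ _ _ _ _ _ inner rest => 1 + inner.numSteps + 1 + rest.numSteps

/-- Every step (linear morph, contraction or uncontraction) is planar. -/
def IsPlanar : {V : Type u} → {G : SimpleGraph V} → {f h : V → Plane} → PseudoMorph G f h → Prop
  | _, _, _, _, nil _ _ => True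
  | _, G, _, _, linear f g _ rest => IsPlanarStep G f g ∧ rest.IsPlanar
  | _, G, _, _, contract f g _ p a _ inner rest =>
      IsPlanarContraction G f p a ∧ inner.IsPlanar ∧ IsPlanarContraction G g p a ∧ rest.IsPlanar

/-- Every step is unidirectional. Contractions and uncontractions move a single vertex along a
segment, so they are so automatically. -/
def IsUnidirectional :
    {V : Type u} → {G : SimpleGraph V} → {f h : V → Plane} → PseudoMorph G f h → Prop
  | _, _, _, _, nil _ _ => True
  | _, _, _, _, linear f g _ rest => IsUnidirectionalStep f g ∧ rest.IsUnidirectional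
  | _, _, _, _, contract _ _ _ _ _ _ inner rest => inner.IsUnidirectional ∧ rest.IsUnidirectional

/-- Every contracted vertex has degree at most `d` in the graph in which it is contracted. -/
def ContractsDegreeLE (d : ℕ) :
    {V : Type u} → {G : SimpleGraph V} → {f h : V → Plane} → PseudoMorph G f h → Prop
  | _, _, _, _, nil _ _ => True
  | _, _, _, _, linear _ _ _ rest => rest.ContractsDegreeLE d
  | _, G, _, _, contract _ _ _ p _ _ inner rest =>
      (G.neighborSet p).ncard ≤ d ∧ inner.ContractsDegreeLE d ∧ rest.ContractsDegreeLE d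

end PseudoMorph

end PlanarMorph

/-!
A contraction of `p` to `a`, a morph of the reduced graph and the uncontraction of `p` are replaced
by a morph of the graph with as many steps: `p` is not merged with `a` but kept at a point
`a + δ • q` very close to it (`hasMorph_of_contraction`). An induction on the pseudo-morph then
gives the result.

*Which directions `q` work.* In the reduced drawing the edges that `a` inherits from `p` fill a
sector at `a`, bounded by the edges to the two common neighbours `b` and `e` of `p` and `a`, and the
other edges of `a` lie in the complementary sector (`Fan`). A direction to the left of `b` and to
the right of `e` (`InSector`) then creates no conflict at `a` (`Fits.of_fan`), and conflicts away
from `a` do not arise when `δ` is small, uniformly over a compact time interval, because planarity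
is an open condition (`exists_isPlanarDrawing_place`). The cyclic order of the edges at `a` does not
change in a planar morph, so the sectors persist.

*Unidirectionality.* When `b`, `e` and `a` move parallel to `l`, a vector in the initial sector can
be moved parallel to `l` into the final sector (`exists_inSector_of_unidirectional`), and it stays
in the moving sector because the determinants that define the sector are affine functions of time.
Sectors are cones, so one small `δ` serves all steps of the morph.

*Start and end.* At the start `q` is the direction of the contraction itself. At the end `p` moves
straight from `a + δ • q` to its final position, which lies in the same sector
(`inSector_of_uncontraction`); only here is it used that `p` is an inner vertex after the
uncontraction.

*Triangulation.* The apexes `b` and `e` exist because every side of every edge carries an empty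
triangle or the outer triangle (`IsTriangulation`). This is derived from the description of the
faces (`IsTriangulated.isTriangulation`), and unlike that description it is readily seen to pass
through planar morphs (`IsTriangulation.step`) and contractions (`IsTriangulation.contract`).
-/

namespace PlanarMorph

open Set Filter Topology

universe u

variable {V : Type u}

/-! ### Orientation in the plane -/

/-- The determinant of two plane vectors. -/
def cross (x y : Plane) : ℝ := x 0 * y 1 - x 1 * y 0

/-- Twice the signed area of the triangle `x y z`; positive when it is counterclockwise. -/
def orient (x y z : Plane) : ℝ := cross (y - x) (z - x)

/-- The point `s` lies in the open triangle with counterclockwise corners `x y z`. -/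
def InTriangle (x y z s : Plane) : Prop :=
  0 < orient x y s ∧ 0 < orient y z s ∧ 0 < orient z x s

/-- The vectors `x` and `y` are nonzero and point in different directions. The encoding says that
parallel vectors must have negative inner product, which also excludes zero vectors. -/
def DirNe (x y : Plane) : Prop := cross x y = 0 → x 0 * y 0 + x 1 * y 1 < 0

/-- The directions of three vectors `u`, `v`, `w` occur in this counterclockwise cyclic order. Of
the three angles between consecutive directions at most one is `π` or more, so two of the
determinants are positive. -/
def Cyc (u v w : Plane) : Prop :=
  (0 < cross u v ∧ 0 < cross v w) ∨ (0 < cross v w ∧ 0 < cross w u) ∨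
    (0 < cross w u ∧ 0 < cross u v)

theorem plane_ext {x y : Plane} (h0 : x 0 = y 0) (h1 : x 1 = y 1) : x = y := by
  ext i
  fin_cases i
  · exact h0
  · exact h1

theorem mem_segment_iff_coord {x y z : Plane} : z ∈ segment ℝ x y ↔
    ∃ t : ℝ, 0 ≤ t ∧ t ≤ 1 ∧ z 0 = (1 - t) * x 0 + t * y 0 ∧ z 1 = (1 - t) * x 1 + t * y 1 := by
  rw [segment_eq_image]
  constructor
  · rintro ⟨t, ⟨h0, h1⟩, rfl⟩
    exact ⟨t, h0, h1, by simp, by simp⟩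
  · rintro ⟨t, h0, h1, e0, e1⟩
    exact ⟨t, ⟨h0, h1⟩, plane_ext (by simp [e0]) (by simp [e1])⟩

theorem orient_eq (x y z : Plane) :
    orient x y z = (y 0 - x 0) * (z 1 - x 1) - (y 1 - x 1) * (z 0 - x 0) := by
  simp [orient, cross]

theorem orient_rotate (x y z : Plane) : orient y z x = orient x y z := by
  simp only [orient_eq]; ring

theorem orient_swap (x y z : Plane) : orient y x z = -orient x y z := by
  simp only [orient_eq]; ring

theorem InTriangle.rotate {x y z s : Plane} (h : InTriangle x y z s) : InTriangle y z x s :=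
  ⟨h.2.1, h.2.2, h.1⟩

theorem cross_swap (x y : Plane) : cross y x = -cross x y := by
  simp only [cross]; ring

theorem cross_add_left (x y z : Plane) : cross (x + y) z = cross x z + cross y z := by
  simp [cross]; ring

theorem cross_add_right (x y z : Plane) : cross x (y + z) = cross x y + cross x z := by
  simp [cross]; ring

theorem cross_smul_left (c : ℝ) (x y : Plane) : cross (c • x) y = c * cross x y := by
  simp [cross]; ring

theorem cross_smul_right (c : ℝ) (x y : Plane) : cross x (c • y) = c * cross x y := by
  simp [cross]; ring

theorem cross_self (x : Plane) : cross x x = 0 := by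
  simp [cross]; ring

/-- The Plücker relation between four plane vectors. -/
theorem cross_relation (u v w z : Plane) :
    cross u v * cross w z + cross v w * cross u z + cross w u * cross v z = 0 := by
  simp only [cross]; ring

@[fun_prop]
theorem continuous_cross : Continuous fun z : Plane × Plane => cross z.1 z.2 := by
  unfold cross; fun_prop

@[fun_prop]
theorem Continuous.cross {X : Type*} [TopologicalSpace X] {u v : X → Plane} (hu : Continuous u)
    (hv : Continuous v) : Continuous fun x => PlanarMorph.cross (u x) (v x) :=
  continuous_cross.comp (hu.prodMk hv)

@[fun_prop]
theorem Continuous.orient {X : Type*} [TopologicalSpace X] {u v w : X → Plane} (hu : Continuous u)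
    (hv : Continuous v) (hw : Continuous w) :
    Continuous fun x => PlanarMorph.orient (u x) (v x) (w x) := by
  unfold PlanarMorph.orient
  exact Continuous.cross (hv.sub hu) (hw.sub hu)

/-- The signed areas are barycentric coordinates of `x` with respect to the triangle `u v w`. -/
theorem mem_segment_of_orient {u v w x : Plane} (h : 0 < orient u v w) (h1 : orient u v x = 0)
    (h2 : 0 ≤ orient v w x) (h3 : 0 ≤ orient w u x) : x ∈ segment ℝ u v := by
  have hs : orient v w x + orient w u x = orient u v w := by
    rw [← add_zero (_ + _), ← h1]; simp only [orient_eq]; ring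
  rw [mem_segment_iff_coord]
  refine ⟨orient w u x / orient u v w, by positivity, ?_, ?_, ?_⟩
  · rw [div_le_one h]; linarith
  · have : orient u v w * x 0 = orient v w x * u 0 + orient w u x * v 0
        + orient u v x * w 0 := by
      simp only [orient_eq]; ring
    rw [h1, ← hs] at this
    rw [← hs] at h ⊢
    field_simp
    linarith
  · have : orient u v w * x 1 = orient v w x * u 1 + orient w u x * v 1
        + orient u v x * w 1 := by
      simp only [orient_eq]; ring
    rw [h1, ← hs] at this
    rw [← hs] at h ⊢
    field_simp
    linarith

theorem orient_of_mem_segment {u v x : Plane} (w : Plane) (h : x ∈ segment ℝ u v) :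
    ∃ t : ℝ, 0 ≤ t ∧ t ≤ 1 ∧ orient u v x = 0 ∧ orient v w x = (1 - t) * orient u v w ∧
      orient w u x = t * orient u v w := by
  obtain ⟨t, h0, h1, e0, e1⟩ := mem_segment_iff_coord.1 h
  refine ⟨t, h0, h1, ?_, ?_, ?_⟩ <;> simp only [orient_eq, e0, e1] <;> ring

/-- A continuous function without zeros on `[0,1]` that is positive at `0` is positive. -/
theorem pos_of_ne_zero {m : ℝ → ℝ} (hc : Continuous m) (hne : ∀ t ∈ Icc (0 : ℝ) 1, m t ≠ 0)
    (h0 : 0 < m 0) : ∀ t ∈ Icc (0 : ℝ) 1, 0 < m t := by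
  intro t ht
  by_contra hneg
  push Not at hneg
  have := intermediate_value_Icc' ht.1 (hc.continuousOn (s := Icc 0 t))
  obtain ⟨s, hs, hs0⟩ := this ⟨hneg, h0.le⟩
  exact hne s ⟨hs.1, hs.2.trans ht.2⟩ hs0

/-- A point moving off the sides of a moving nondegenerate triangle stays inside or outside. -/
theorem inTriangle_path {u v w s : ℝ → Plane} (hu : Continuous u) (hv : Continuous v)
    (hw : Continuous w) (hs : Continuous s)
    (hpos : ∀ t ∈ Icc (0 : ℝ) 1, 0 < orient (u t) (v t) (w t))
    (hoff : ∀ t ∈ Icc (0 : ℝ) 1, s t ∉ segment ℝ (u t) (v t) ∧ s t ∉ segment ℝ (v t) (w t) ∧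
      s t ∉ segment ℝ (w t) (u t)) :
    ∀ t ∈ Icc (0 : ℝ) 1,
      (InTriangle (u 0) (v 0) (w 0) (s 0) ↔ InTriangle (u t) (v t) (w t) (s t)) := by
  set m : ℝ → ℝ := fun t => min (orient (u t) (v t) (s t))
    (min (orient (v t) (w t) (s t)) (orient (w t) (u t) (s t))) with hm
  have hin : ∀ t, InTriangle (u t) (v t) (w t) (s t) ↔ 0 < m t := by
    intro t; simp [hm, InTriangle]
  have hmc : Continuous m := by
    simp only [hm]; fun_prop
  have hne : ∀ t ∈ Icc (0 : ℝ) 1, m t ≠ 0 := by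
    intro t ht h0
    obtain ⟨o1, o2, o3⟩ := hoff t ht
    have hp := hpos t ht
    have hp2 := (orient_rotate (u t) (v t) (w t)).symm ▸ hp
    have hp3 := (orient_rotate (v t) (w t) (u t)).symm ▸ hp2
    have l1 : m t ≤ orient (u t) (v t) (s t) := min_le_left _ _
    have l2 : m t ≤ orient (v t) (w t) (s t) := (min_le_right _ _).trans (min_le_left _ _)
    have l3 : m t ≤ orient (w t) (u t) (s t) := (min_le_right _ _).trans (min_le_right _ _)
    rw [h0] at l1 l2 l3
    have hc : m t = orient (u t) (v t) (s t) ∨ m t = orient (v t) (w t) (s t) ∨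
        m t = orient (w t) (u t) (s t) := by
      simp only [hm]
      rcases min_choice (orient (u t) (v t) (s t))
        (min (orient (v t) (w t) (s t)) (orient (w t) (u t) (s t))) with h | h
      · exact Or.inl h
      · rcases min_choice (orient (v t) (w t) (s t)) (orient (w t) (u t) (s t)) with h' | h'
        · exact Or.inr (Or.inl (h.trans h'))
        · exact Or.inr (Or.inr (h.trans h'))
    rw [h0] at hc
    rcases hc with hc | hc | hc
    · exact o1 (mem_segment_of_orient hp hc.symm l2 l3)
    · exact o2 (mem_segment_of_orient hp2 hc.symm l3 l1)
    · exact o3 (mem_segment_of_orient hp3 hc.symm l1 l2)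
  intro t ht
  rw [hin, hin]
  constructor
  · intro h; exact pos_of_ne_zero hmc hne h t ht
  · intro h
    by_contra h0
    have h0' : m 0 < 0 := lt_of_le_of_ne (not_lt.1 h0) (hne 0 ⟨le_rfl, zero_le_one⟩)
    have := pos_of_ne_zero (m := fun t => -m t) hmc.neg (fun t ht => neg_ne_zero.2 (hne t ht))
      (by simpa using h0') t ht
    linarith

/-! ### Directions and their cyclic order -/

theorem DirNe.symm {x y : Plane} (h : DirNe x y) : DirNe y x := by
  intro hc
  have := h (by rw [cross_swap, hc, neg_zero])
  linarith

/-- A vector parallel to `x ≠ 0` is its orthogonal projection to the line spanned by `x`. -/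
theorem eq_smul_of_cross_eq_zero {x y : Plane} (hx : x ≠ 0) (h : cross x y = 0) :
    0 < x 0 ^ 2 + x 1 ^ 2 ∧ y = ((x 0 * y 0 + x 1 * y 1) / (x 0 ^ 2 + x 1 ^ 2)) • x := by
  have hpos : 0 < x 0 ^ 2 + x 1 ^ 2 := by
    by_contra hn
    apply hx
    apply plane_ext <;> simp <;> nlinarith [sq_nonneg (x 0), sq_nonneg (x 1)]
  refine ⟨hpos, ?_⟩
  unfold cross at h
  apply plane_ext
  · simp only [PiLp.smul_apply, smul_eq_mul]
    field_simp
    linear_combination (-x 1) * h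
  · simp only [PiLp.smul_apply, smul_eq_mul]
    field_simp
    linear_combination (x 0) * h

theorem DirNe.left_ne_zero {x y : Plane} (h : DirNe x y) : x ≠ 0 := by
  rintro rfl
  have := h (by simp [cross])
  simp at this

theorem dirNe_iff {x y : Plane} : DirNe x y ↔ x ≠ 0 ∧ y ≠ 0 ∧ ∀ c : ℝ, 0 < c → y ≠ c • x := by
  constructor
  · intro h
    refine ⟨h.left_ne_zero, h.symm.left_ne_zero, ?_⟩
    rintro c hc rfl
    have := h (by rw [cross_smul_right, cross_self, mul_zero])
    simp only [PiLp.smul_apply, smul_eq_mul] at this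
    nlinarith [mul_nonneg hc.le (sq_nonneg (x 0)), mul_nonneg hc.le (sq_nonneg (x 1))]
  · rintro ⟨hx, hy, h⟩ hc
    obtain ⟨hp, he⟩ := eq_smul_of_cross_eq_zero hx hc
    by_contra hn
    rcases (not_lt.1 hn).lt_or_eq with h0 | h0
    · exact h _ (by positivity) he
    · rw [← h0] at he
      exact hy (by simpa using he)

/-- Parallel vectors of different directions are opposite. -/
theorem DirNe.exists_neg {x y : Plane} (h : DirNe x y) (hc : cross x y = 0) :
    ∃ c : ℝ, 0 < c ∧ y = (-c) • x := by
  obtain ⟨hp, he⟩ := eq_smul_of_cross_eq_zero h.left_ne_zero hc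
  exact ⟨_, div_pos (neg_pos.2 (h hc)) hp, by rw [neg_div, neg_neg]; exact he⟩

/-- The case of `cyc_or_cyc` in which two of the directions are opposite; the third one then lies
on one of the two sides of their line. -/
theorem cyc_of_cross_eq_zero {u v w : Plane} (huv : DirNe u v) (hvw : DirNe v w) (hwu : DirNe w u)
    (h : cross u v = 0) : Cyc u v w ∨ Cyc w v u := by
  obtain ⟨c, hc, rfl⟩ := huv.exists_neg h
  have h1 : cross w u ≠ 0 := by
    intro h0
    obtain ⟨d, hd, rfl⟩ := hwu.symm.exists_neg (by rw [cross_swap, h0, neg_zero])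
    refine (dirNe_iff.1 hvw).2.2 (d / c) (by positivity) ?_
    rw [smul_smul]
    congr 1
    field_simp
  have h2 : cross (-c • u) w = c * cross w u := by
    rw [cross_smul_left, cross_swap w u]; ring
  have h3 : cross w (-c • u) = - (c * cross w u) := by rw [cross_swap, h2]
  have h4 : cross u w = - cross w u := cross_swap _ _
  unfold Cyc
  rw [h2, h3, h4]
  rcases lt_or_gt_of_ne h1 with h1 | h1
  · right; right; right
    exact ⟨by linarith, by nlinarith⟩
  · left; right; left
    exact ⟨by positivity, h1⟩

theorem Cyc.rotate {u v w : Plane} (h : Cyc u v w) : Cyc v w u := by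
  unfold Cyc at *; tauto

/-- Three different directions are in counterclockwise or in clockwise order. -/
theorem cyc_or_cyc {u v w : Plane} (huv : DirNe u v) (hvw : DirNe v w) (hwu : DirNe w u) :
    Cyc u v w ∨ Cyc w v u := by
  by_cases h1 : cross u v = 0
  · exact cyc_of_cross_eq_zero huv hvw hwu h1
  by_cases h2 : cross v w = 0
  · rcases cyc_of_cross_eq_zero hvw hwu huv h2 with h | h
    · exact Or.inl h.rotate.rotate
    · exact Or.inr h.rotate
  by_cases h3 : cross w u = 0
  · rcases cyc_of_cross_eq_zero hwu huv hvw h3 with h | h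
    · exact Or.inl h.rotate
    · exact Or.inr h.rotate.rotate
  unfold Cyc
  rw [cross_swap v w, cross_swap u v, cross_swap w u]
  simp only [Left.neg_pos_iff]
  have h1 := lt_or_gt_of_ne h1
  have h2 := lt_or_gt_of_ne h2
  have h3 := lt_or_gt_of_ne h3
  tauto

theorem Cyc.not_rev {u v w : Plane} (h : Cyc u v w) : ¬ Cyc w v u := by
  unfold Cyc at *
  rw [cross_swap v w, cross_swap u v, cross_swap w u]
  rintro (⟨h1, h2⟩ | ⟨h1, h2⟩ | ⟨h1, h2⟩) <;>
  rcases h with ⟨h3, h4⟩ | ⟨h3, h4⟩ | ⟨h3, h4⟩ <;> linarith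

theorem cyc_iff_median {u v w : Plane} : Cyc u v w ↔
    0 < max (min (cross u v) (cross v w)) (max (min (cross v w) (cross w u))
      (min (cross w u) (cross u v))) := by
  simp [Cyc]

/-- The cyclic order of three directions that stay different does not change. -/
theorem cyc_path {u v w : ℝ → Plane} (hu : Continuous u) (hv : Continuous v) (hw : Continuous w)
    (h : ∀ t ∈ Icc (0 : ℝ) 1, DirNe (u t) (v t) ∧ DirNe (v t) (w t) ∧ DirNe (w t) (u t))
    (h0 : Cyc (u 0) (v 0) (w 0)) : ∀ t ∈ Icc (0 : ℝ) 1, Cyc (u t) (v t) (w t) := by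
  intro t ht
  rw [cyc_iff_median] at h0 ⊢
  refine pos_of_ne_zero (m := fun t => max (min (cross (u t) (v t)) (cross (v t) (w t)))
    (max (min (cross (v t) (w t)) (cross (w t) (u t)))
      (min (cross (w t) (u t)) (cross (u t) (v t))))) (by fun_prop) ?_ h0 t ht
  intro s hs hz
  obtain ⟨a1, a2, a3⟩ := h s hs
  rcases cyc_or_cyc a1 a2 a3 with hc | hc
  · rw [cyc_iff_median] at hc
    exact hc.ne' hz
  · -- in clockwise order two of the determinants are negative, hence so is the median
    unfold Cyc at hc
    rw [cross_swap (v s) (w s), cross_swap (u s) (v s), cross_swap (w s) (u s)] at hc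
    simp only [Left.neg_pos_iff] at hc
    refine absurd hz (ne_of_lt ?_)
    simp only [max_lt_iff, min_lt_iff]
    tauto

/-! ### Sectors and fans of directions -/

/-- The intersection of the half-plane to the left of `b` and the half-plane to the right of `e`:
the directions in which a point may leave the origin if the segments to `b` and to `e` are to stay
on the sides of the sector running counterclockwise from `b` to `e`. -/
def InSector (b e q : Plane) : Prop := 0 < cross b q ∧ 0 < cross q e

/-- A point close to the origin in direction `q` can be joined to the points `w n`, `n ∈ N`, by
segments that do not meet the segments from the origin to the points `w x`, `x ∈ A`. -/
structure Fits {ι : Type*} (w : ι → Plane) (N A : Set ι) (q : Plane) : Prop where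
  ne_zero : q ≠ 0
  off : ∀ x ∈ A, ∀ α : ℝ, 0 < α → w x ≠ α • q
  opposite : ∀ n ∈ N, ∀ α : ℝ, 0 < α → w n ≠ (-α) • q
  between : ∀ n ∈ N, ∀ x ∈ A, n ≠ x → ∀ α β : ℝ, 0 < α → 0 < β → w x ≠ α • q + β • w n

/-- The directions `w n`, `n ∈ N`, lie in the sector from `w b` counterclockwise to `w e`, and the
directions `w x`, `x ∈ A`, in the complementary sector. -/
structure Fan {ι : Type*} (w : ι → Plane) (N A : Set ι) (b e : ι) : Prop where
  inner : ∀ n ∈ N, n ≠ b → n ≠ e → Cyc (w b) (w n) (w e)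
  outer : ∀ x ∈ A, x ≠ b → x ≠ e → Cyc (w b) (w e) (w x)

/-- Cramer's rule. -/
theorem eq_smul_add_smul {u v : Plane} (w : Plane) (h : cross u v ≠ 0) :
    w = (cross w v / cross u v) • u + (cross u w / cross u v) • v := by
  apply plane_ext <;> simp only [PiLp.add_apply, PiLp.smul_apply, smul_eq_mul] <;>
    field_simp <;> simp only [cross] <;> ring

/-- If the segment from a point near the origin in direction `q`, in the sector from `b` to `e`, to
the point `c` crosses neither the segment to `b` nor the segment to `e`, then `c` comes between `b`
and `e`. -/
theorem cyc_of_inSector {b e c q : Plane} (hq : InSector b e q) (hbc : DirNe b c)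
    (hec : DirNe e c) (hopp : ∀ α : ℝ, 0 < α → c ≠ (-α) • q)
    (hb : ∀ α β : ℝ, 0 < α → 0 < β → b ≠ α • q + β • c)
    (he : ∀ α β : ℝ, 0 < α → 0 < β → e ≠ α • q + β • c) : Cyc b c e := by
  obtain ⟨h1, h2⟩ := hq
  have hq0 : q ≠ 0 := by rintro rfl; simp [cross] at h1
  have hrel := cross_relation b c e q
  rw [cross_swap q e, cross_swap q c] at hrel
  rcases lt_trichotomy (cross q c) 0 with h | h | h
  · have h3 : 0 < cross b c := by
      by_contra hn
      rcases (not_lt.1 hn).lt_or_eq with h4 | h4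
      · refine hb _ _ ?_ ?_ (eq_smul_add_smul b h.ne)
        · exact div_pos_of_neg_of_neg h4 h
        · exact div_pos_of_neg_of_neg (by rw [cross_swap]; linarith) h
      · obtain ⟨d, hd, rfl⟩ := hbc.exists_neg h4
        rw [cross_smul_right, cross_swap b q] at h
        nlinarith
    refine or_iff_not_imp_left.2 fun hn => Or.inr ⟨?_, h3⟩
    have h5 : cross c e ≤ 0 := by
      by_contra h6; exact hn ⟨h3, by linarith⟩
    by_contra h6
    nlinarith
  · obtain ⟨hp, hc⟩ := eq_smul_of_cross_eq_zero hq0 h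
    set d := (q 0 * c 0 + q 1 * c 1) / (q 0 ^ 2 + q 1 ^ 2)
    have hd : 0 < d := by
      rcases lt_trichotomy d 0 with hd | hd | hd
      · exact absurd (by simpa using hc) (hopp (-d) (by linarith))
      · rw [hd, zero_smul] at hc; exact absurd hc hbc.symm.left_ne_zero
      · exact hd
    left
    rw [hc, cross_smul_right, cross_smul_left]
    exact ⟨by positivity, by positivity⟩
  · have h3 : 0 < cross c e := by
      by_contra hn
      rcases (not_lt.1 hn).lt_or_eq with h4 | h4
      · refine he _ _ ?_ ?_ (eq_smul_add_smul e h.ne')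
        · exact div_pos (by rw [cross_swap]; linarith) h
        · exact div_pos h2 h
      · obtain ⟨d, hd, rfl⟩ := hec.exists_neg (by rw [cross_swap, h4, neg_zero])
        rw [cross_smul_right] at h
        nlinarith
    refine or_iff_not_imp_left.2 fun hn => Or.inl ⟨h3, ?_⟩
    have h5 : cross b c ≤ 0 := by
      by_contra h6; exact hn ⟨by linarith, h3⟩
    by_contra h6
    nlinarith

/-- If the segment from the origin to `x` meets neither of the segments to `b` and to `e` from a
point near the origin in direction `q`, in the sector from `b` to `e`, then `x` comes between `e`
and `b`. -/
theorem cyc_of_not_inSector {b e x q : Plane} (hq : InSector b e q) (hbx : DirNe b x)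
    (hex : DirNe e x) (hoff : ∀ α : ℝ, 0 < α → x ≠ α • q)
    (hb : ∀ α β : ℝ, 0 < α → 0 < β → x ≠ α • q + β • b)
    (he : ∀ α β : ℝ, 0 < α → 0 < β → x ≠ α • q + β • e) : Cyc b e x := by
  obtain ⟨h1, h2⟩ := hq
  have hq0 : q ≠ 0 := by rintro rfl; simp [cross] at h1
  have hrel := cross_relation b e x q
  rw [cross_swap q x, cross_swap q e] at hrel
  rcases lt_trichotomy (cross q x) 0 with h | h | h
  · have h3 : 0 < cross x b := by
      by_contra hn
      rcases (not_lt.1 hn).lt_or_eq with h4 | h4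
      · have hqb : cross q b < 0 := by rw [cross_swap]; linarith
        refine hb _ _ ?_ ?_ (eq_smul_add_smul x hqb.ne)
        · exact div_pos_of_neg_of_neg h4 hqb
        · exact div_pos_of_neg_of_neg h hqb
      · obtain ⟨d, hd, rfl⟩ := hbx.exists_neg (by rw [cross_swap, h4, neg_zero])
        rw [cross_smul_right, cross_swap b q] at h
        nlinarith
    by_cases h4 : 0 < cross e x
    · exact Or.inr (Or.inl ⟨h4, h3⟩)
    · refine Or.inr (Or.inr ⟨h3, ?_⟩)
      by_contra h5
      nlinarith
  · obtain ⟨hp, hc⟩ := eq_smul_of_cross_eq_zero hq0 h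
    set d := (q 0 * x 0 + q 1 * x 1) / (q 0 ^ 2 + q 1 ^ 2)
    have hd : d < 0 := by
      rcases lt_trichotomy d 0 with hd | hd | hd
      · exact hd
      · rw [hd, zero_smul] at hc; exact absurd hc hbx.symm.left_ne_zero
      · exact absurd hc (hoff d hd)
    right; left
    rw [hc, cross_smul_right, cross_smul_left, cross_swap q e, cross_swap b q]
    constructor <;> nlinarith
  · have h3 : 0 < cross e x := by
      by_contra hn
      rcases (not_lt.1 hn).lt_or_eq with h4 | h4
      · refine he _ _ ?_ ?_ (eq_smul_add_smul x h2.ne')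
        · exact div_pos (by rw [cross_swap]; linarith) h2
        · exact div_pos h h2
      · obtain ⟨d, hd, rfl⟩ := hex.exists_neg h4
        rw [cross_smul_right] at h
        nlinarith
    by_cases h4 : 0 < cross x b
    · exact Or.inr (Or.inl ⟨h3, h4⟩)
    · refine Or.inl ⟨?_, h3⟩
      by_contra h5
      nlinarith

/-- A direction `q` from which `b` and `e` can both be reached lies in one of the two sectors
between `b` and `e`. -/
theorem inSector_or_inSector {b e q : Plane} (hbe : DirNe b e) (hqb : DirNe q b)
    (hqe : DirNe q e) (hb' : ∀ α : ℝ, 0 < α → b ≠ (-α) • q)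
    (he' : ∀ α : ℝ, 0 < α → e ≠ (-α) • q)
    (hb : ∀ α β : ℝ, 0 < α → 0 < β → b ≠ α • q + β • e)
    (he : ∀ α β : ℝ, 0 < α → 0 < β → e ≠ α • q + β • b) : InSector b e q ∨ InSector e b q := by
  have nb : cross q b ≠ 0 := fun h => by
    obtain ⟨c, hc, h⟩ := hqb.exists_neg h
    exact hb' c hc h
  have ne : cross q e ≠ 0 := fun h => by
    obtain ⟨c, hc, h⟩ := hqe.exists_neg h
    exact he' c hc h
  unfold InSector
  rw [cross_swap q b, cross_swap q e]
  by_contra hn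
  rw [not_or, not_and_or, not_and_or] at hn
  -- `b` and `e` lie on the same side of the line spanned by `q`
  have hs : 0 < cross q b * cross q e := by
    rcases lt_or_gt_of_ne nb with h | h <;> rcases lt_or_gt_of_ne ne with h' | h'
    · exact mul_pos_of_neg_of_neg h h'
    · exfalso; rcases hn.1 with h3 | h3 <;> linarith
    · exfalso; rcases hn.2 with h3 | h3 <;> linarith
    · positivity
  have hr : 0 < cross q e / cross q b := by
    have : cross q e / cross q b = (cross q b * cross q e) / (cross q b) ^ 2 := by field_simp
    rw [this]; positivity
  have e1 := eq_smul_add_smul e nb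
  rcases lt_trichotomy (cross e b / cross q b) 0 with h | h | h
  · refine hb (-(cross e b / cross q b) / (cross q e / cross q b)) (1 / (cross q e / cross q b))
      (div_pos (by linarith) hr) (by positivity) ?_
    have hne := hr.ne'
    set γ := cross q e / cross q b
    set δ := cross e b / cross q b
    rw [e1]
    apply plane_ext <;> simp <;> field_simp <;> ring
  · rw [h, zero_smul, zero_add] at e1
    exact (dirNe_iff.1 hbe).2.2 _ hr e1
  · exact he _ _ h hr e1

/-- In the sector between `b` and `e` the segments to the points of `N` turn from `q` towards their
end points within the sector of the fan, which contains no `w x` in its interior. -/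
theorem Fits.of_fan {ι : Type*} {w : ι → Plane} {N A : Set ι} {b e : ι} {q : Plane}
    (h : Fan w N A b e) (hq : InSector (w b) (w e) q) : Fits w N A q := by
  obtain ⟨h1, h2⟩ := hq
  have h1' : cross q (w b) < 0 := by rw [cross_swap]; linarith
  have h2' : cross (w e) q < 0 := by rw [cross_swap]; linarith
  refine ⟨?_, ?_, ?_, ?_⟩
  · rintro rfl; simp [cross] at h1
  · intro x hx α hα hxq
    have e1 : cross (w b) (w x) = α * cross (w b) q := by rw [hxq, cross_smul_right]
    have e2 : cross (w e) (w x) = α * cross (w e) q := by rw [hxq, cross_smul_right]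
    have p1 := mul_pos hα h1
    have p2 := mul_neg_of_pos_of_neg hα h2'
    by_cases hxb : x = b
    · subst hxb; rw [cross_self] at e1; linarith
    by_cases hxe : x = e
    · subst hxe; rw [cross_self] at e2; linarith
    have hc := h.outer x hx hxb hxe
    unfold Cyc at hc
    rw [cross_swap (w b) (w x)] at hc
    rcases hc with hc | hc | hc <;> linarith [hc.1, hc.2]
  · intro n hn α hα hnq
    have e1 : cross (w b) (w n) = -(α * cross (w b) q) := by rw [hnq, cross_smul_right]; ring
    have e2 : cross (w n) (w e) = -(α * cross q (w e)) := by rw [hnq, cross_smul_left]; ring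
    have p1 := mul_pos hα h1
    have p2 := mul_pos hα h2
    by_cases hnb : n = b
    · subst hnb; rw [cross_self] at e1; linarith
    by_cases hne : n = e
    · subst hne; rw [cross_self] at e2; linarith
    have hc := h.inner n hn hnb hne
    unfold Cyc at hc
    rcases hc with hc | hc | hc <;> linarith [hc.1, hc.2]
  · intro n hn x hx hnx α β hα hβ hxq
    have e1 : cross (w b) (w x) = α * cross (w b) q + β * cross (w b) (w n) := by
      rw [hxq, cross_add_right, cross_smul_right, cross_smul_right]
    have e2 : cross (w x) (w e) = α * cross q (w e) + β * cross (w n) (w e) := by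
      rw [hxq, cross_add_left, cross_smul_left, cross_smul_left]
    have p1 := mul_pos hα h1
    have p2 := mul_pos hα h2
    have s1 := cross_swap (w b) (w x)
    have s2 := cross_swap (w x) (w e)
    have s3 := cross_swap (w b) (w e)
    have hN : n = b ∨ n = e ∨ Cyc (w b) (w n) (w e) := by
      have := h.inner n hn; tauto
    have hA : x = b ∨ x = e ∨ Cyc (w b) (w e) (w x) := by
      have := h.outer x hx; tauto
    have m1 := mul_pos (a := β) (b := cross (w b) (w n)) hβ
    have m2 := mul_pos (a := β) (b := cross (w n) (w e)) hβ
    have m3 := mul_pos (a := β) (b := cross (w e) (w b)) hβ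
    have m4 := mul_pos (a := β) (b := cross (w b) (w e)) hβ
    rcases hN with rfl | rfl | hN
    · rw [cross_self] at e1
      rcases hA with rfl | rfl | hA
      · exact hnx rfl
      · rw [cross_self] at e2
        rw [mul_zero] at e1
        have : 0 < β * cross (w n) (w x) := mul_pos hβ (by linarith)
        linarith
      · rcases hA with hA | hA | hA
        · linarith [m4 hA.1]
        · linarith
        · linarith
    · rw [cross_self] at e2
      rcases hA with rfl | rfl | hA
      · rw [cross_self] at e1
        rw [mul_zero] at e2
        have : 0 < β * cross (w x) (w n) := mul_pos hβ (by linarith)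
        linarith
      · exact hnx rfl
      · rcases hA with hA | hA | hA
        · linarith
        · linarith
        · linarith [m4 hA.2]
    · rcases hA with rfl | rfl | hA
      · rw [cross_self] at e1
        rcases hN with hN | hN | hN
        · linarith [m1 hN.1]
        · linarith [m2 hN.1]
        · linarith [m1 hN.2]
      · rw [cross_self] at e2
        rcases hN with hN | hN | hN
        · linarith [m2 hN.2]
        · linarith [m2 hN.1]
        · linarith [m1 hN.2]
      · rcases hN with hN | hN | hN <;> rcases hA with hA | hA | hA <;>
          first
          | linarith [m1 hN.1, m2 hN.2]
          | linarith [m2 hN.1]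
          | linarith [m1 hN.2]

theorem Fan.of_fits {ι : Type*} {w : ι → Plane} {N A : Set ι} {b e : ι} {q : Plane}
    (h : Fits w N A q) (hq : InSector (w b) (w e) q) (hb : b ∈ N ∩ A) (he : e ∈ N ∩ A)
    (hdir : ∀ i ∈ N ∪ A, ∀ j ∈ N ∪ A, i ≠ j → DirNe (w i) (w j)) : Fan w N A b e := by
  constructor
  · intro n hn hnb hne
    exact cyc_of_inSector hq (hdir b (Or.inl hb.1) n (Or.inl hn) hnb.symm)
      (hdir e (Or.inl he.1) n (Or.inl hn) hne.symm) (h.opposite n hn)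
      (h.between n hn b hb.2 hnb) (h.between n hn e he.2 hne)
  · intro x hx hxb hxe
    exact cyc_of_not_inSector hq (hdir b (Or.inl hb.1) x (Or.inr hx) hxb.symm)
      (hdir e (Or.inl he.1) x (Or.inr hx) hxe.symm) (h.off x hx)
      (h.between b hb.1 x hx hxb.symm) (h.between e he.1 x hx hxe.symm)

/-- If `b` and `e` move parallel to `l` without ever pointing in the same direction, then a vector
in their sector can be moved parallel to `l` into the final sector. Transversally to `l` the two
bounds on the displacement `s` are compatible because `cross b e` keeps its sign. -/
theorem exists_inSector_of_unidirectional {b e q l : Plane} {β γ : ℝ} (hq : InSector b e q)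
    (hbe : ∀ t ∈ Icc (0 : ℝ) 1, DirNe (b + (t * β) • l) (e + (t * γ) • l)) :
    ∃ s : ℝ, InSector (b + β • l) (e + γ • l) (q + s • l) := by
  obtain ⟨h1, h2⟩ := hq
  have x1 : ∀ s, cross (b + β • l) (q + s • l) = cross (b + β • l) q + s * cross b l := by
    intro s; simp [cross]; ring
  have x2 : ∀ s, cross (q + s • l) (e + γ • l) = cross q (e + γ • l) + s * cross l e := by
    intro s; simp [cross]; ring
  -- a vector parallel to `l` keeps its direction, so the bound it gives does not change
  have key : ∀ (u : Plane) (δ : ℝ), (∀ t ∈ Icc (0 : ℝ) 1, u + (t * δ) • l ≠ 0) → cross u l = 0 →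
      ∃ c : ℝ, 0 < c ∧ u + δ • l = c • u := by
    intro u δ hu h0
    have hu0 : u ≠ 0 := by simpa using hu 0 ⟨le_rfl, zero_le_one⟩
    obtain ⟨-, hl⟩ := eq_smul_of_cross_eq_zero hu0 h0
    set d := (u 0 * l 0 + u 1 * l 1) / (u 0 ^ 2 + u 1 ^ 2)
    have hne : ∀ t ∈ Icc (0 : ℝ) 1, 1 + t * δ * d ≠ 0 := by
      intro t ht h
      apply hu t ht
      rw [hl, smul_smul]
      nth_rewrite 1 [← one_smul ℝ u]
      rw [← add_smul, h, zero_smul]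
    refine ⟨1 + δ * d, ?_, ?_⟩
    · have := pos_of_ne_zero (m := fun t => 1 + t * δ * d) (by fun_prop) hne (by simp) 1
        ⟨zero_le_one, le_rfl⟩
      simpa using this
    · rw [add_smul, one_smul, mul_smul, ← hl]
  unfold InSector
  simp only [x1, x2]
  have hB : cross b l = 0 → 0 < cross (b + β • l) q := by
    intro h0
    obtain ⟨c, hc, h⟩ := key b β (fun t ht => (hbe t ht).left_ne_zero) h0
    rw [h, cross_smul_left]; positivity
  have hE : cross l e = 0 → 0 < cross q (e + γ • l) := by
    intro h0
    obtain ⟨c, hc, h⟩ := key e γ (fun t ht => (hbe t ht).symm.left_ne_zero)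
        (by rw [cross_swap, h0, neg_zero])
    rw [h, cross_smul_right]; positivity
  set P := cross (b + β • l) q with hP
  set Q := cross q (e + γ • l) with hQ
  set B := cross b l with hBdef
  set E := cross l e with hEdef
  rcases eq_or_ne B 0 with hB0 | hB0
  · have hB := hB hB0
    rcases eq_or_ne E 0 with hE0 | hE0
    · have hE := hE hE0
      exact ⟨0, by simpa using hB, by simpa using hE⟩
    · refine ⟨(1 - Q) / E, by rw [hB0]; simpa using hB, ?_⟩
      rw [div_mul_cancel₀ _ hE0]; linarith
  rcases eq_or_ne E 0 with hE0 | hE0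
  · have hE := hE hE0
    refine ⟨(1 - P) / B, ?_, by rw [hE0]; simpa using hE⟩
    rw [div_mul_cancel₀ _ hB0]; linarith
  rcases lt_or_gt_of_ne (mul_ne_zero hB0 hE0) with hBE | hBE
  · have hmain : ∀ t ∈ Icc (0 : ℝ) 1, cross (b + (t * β) • l) (e + (t * γ) • l) ≠ 0 := by
      intro t ht h0
      obtain ⟨c, hc, h⟩ := (hbe t ht).exists_neg h0
      have a1 : cross (b + (t * β) • l) l = B := by simp [cross, hBdef]; ring
      have a2 : cross l (e + (t * γ) • l) = E := by simp [cross, hEdef]; ring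
      rw [h, cross_smul_right, cross_swap _ l, a1] at a2
      rw [← a2] at hBE
      nlinarith [mul_nonneg hc.le (sq_nonneg B)]
    have r0 := cross_relation b q e l
    have r1 := cross_relation (b + β • l) q (e + γ • l) l
    have a1 : cross (b + β • l) l = B := by simp [cross, hBdef]; ring
    have a2 : cross (e + γ • l) l = -E := by simp [cross, hEdef]; ring
    have a3 : cross e l = -E := by rw [hEdef, cross_swap]
    rw [a1, a2, ← hP, ← hQ, cross_swap (b + β • l)] at r1
    rw [a3, ← hBdef, cross_swap b] at r0
    have hsign : 0 < cross b e * cross (b + β • l) (e + γ • l) := by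
      have h0 := hmain 0 ⟨le_rfl, zero_le_one⟩
      rw [zero_mul, zero_smul, add_zero, zero_mul, zero_smul, add_zero] at h0
      have := pos_of_ne_zero
        (m := fun t => cross b e * cross (b + (t * β) • l) (e + (t * γ) • l)) (by fun_prop)
        (fun t ht => mul_ne_zero h0 (hmain t ht))
        (by
          simp only [zero_mul, zero_smul, add_zero]
          exact mul_self_pos.2 h0) 1 ⟨zero_le_one, le_rfl⟩
      simpa only [one_mul] using this
    set K₀ := cross b e
    set K₁ := cross (b + β • l) (e + γ • l)
    set X := cross q l
    have hE2 : 0 < E ^ 2 := by positivity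
    have n0 : K₀ * X * E < 0 := by
      have : K₀ * X * E = cross q e * (B * E) - cross b q * E ^ 2 := by linear_combination -E * r0
      rw [this]
      linarith [mul_pos h1 hE2, mul_neg_of_pos_of_neg h2 hBE]
    have n1 : K₁ * X * E < 0 := by
      have := mul_neg_of_neg_of_pos n0 hsign
      have h3 : K₀ ^ 2 * (K₁ * X * E) < 0 := by linarith
      exact neg_of_mul_neg_right h3 (sq_nonneg _)
    have hPQ : 0 < (P * E - Q * B) * E := by
      have : (P * E - Q * B) * E = -(K₁ * X * E) := by linear_combination -E * r1
      linarith
    -- the midpoint of the two bounds on the displacement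
    refine ⟨((-P / B) + (-Q / E)) / 2, ?_, ?_⟩
    · have : P + (-P / B + -Q / E) / 2 * B = ((P * E - Q * B) * E) / (2 * E ^ 2) := by
        field_simp; ring
      rw [this]; positivity
    · have : Q + (-P / B + -Q / E) / 2 * E = ((P * E - Q * B) * E) / (2 * -(B * E)) := by
        field_simp; ring
      rw [this]
      exact div_pos hPQ (by linarith)
  · -- both bounds have the same sense: a large displacement works
    have hB2 : 0 < B ^ 2 := by positivity
    refine ⟨(|P| / B ^ 2 + |Q| / (B * E) + 1) * B, ?_, ?_⟩
    · have i1 : |P| / B ^ 2 * B ^ 2 = |P| := div_mul_cancel₀ _ hB2.ne'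
      have i2 : 0 ≤ |Q| / (B * E) * B ^ 2 := by positivity
      nlinarith [neg_abs_le P]
    · have i1 : |Q| / (B * E) * (B * E) = |Q| := div_mul_cancel₀ _ hBE.ne'
      have i2 : 0 ≤ |P| / B ^ 2 * (B * E) := by positivity
      nlinarith [neg_abs_le Q]

/-! ### Planar drawings -/

/-- `u = v` or `u v` is an edge: in either case the segment between the positions of `u` and `v` is
part of the drawing. -/
def Cell (G : SimpleGraph V) (u v : V) : Prop := u = v ∨ G.Adj u v

theorem Cell.symm {G : SimpleGraph V} {u v : V} (h : Cell G u v) : Cell G v u :=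
  h.imp Eq.symm SimpleGraph.Adj.symm

theorem IsPlanarDrawing.disjoint {G : SimpleGraph V} {f : V → Plane} (h : IsPlanarDrawing G f)
    {u v x y : V} (huv : Cell G u v) (hxy : Cell G x y) (h1 : u ≠ x) (h2 : u ≠ y) (h3 : v ≠ x)
    (h4 : v ≠ y) : Disjoint (segment ℝ (f u) (f v)) (segment ℝ (f x) (f y)) := by
  rcases huv with rfl | huv <;> rcases hxy with rfl | hxy
  · simpa [segment_same] using fun hh => h1 (h.injective hh)
  · simpa [segment_same] using h.vertex_edge x y u hxy h1 h2
  · simpa [segment_same] using h.vertex_edge u v x huv h1.symm h3.symm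
  · rw [← insert_endpoints_openSegment, ← insert_endpoints_openSegment, disjoint_left]
    have hs : s(u, v) ≠ s(x, y) := by
      rw [Ne, Sym2.eq_iff]; tauto
    have hd := disjoint_left.1 (h.edge_edge u v x y huv hxy hs)
    intro z hz hz'
    rw [insert_endpoints_openSegment] at hz'
    rcases hz with rfl | rfl | hz
    · exact h.vertex_edge x y u hxy h1 h2 hz'
    · exact h.vertex_edge x y v hxy h3 h4 hz'
    · rw [← insert_endpoints_openSegment] at hz'
      rcases hz' with rfl | rfl | hz'
      · exact h.vertex_edge u v x huv h1.symm h3.symm (openSegment_subset_segment _ _ _ hz)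
      · exact h.vertex_edge u v y huv h2.symm h4.symm (openSegment_subset_segment _ _ _ hz)
      · exact hd hz hz'

theorem dirNe_of_not_mem_segment {a x y : Plane} (hx : x ∉ segment ℝ a y) (hy : y ∉ segment ℝ a x) :
    DirNe (x - a) (y - a) := by
  rw [dirNe_iff]
  refine ⟨?_, ?_, ?_⟩
  · intro h
    rw [sub_eq_zero] at h
    exact hx (h ▸ left_mem_segment _ _ _)
  · intro h
    rw [sub_eq_zero] at h
    exact hy (h ▸ left_mem_segment _ _ _)
  · intro c hc h
    have e0 := congrArg (fun z : Plane => z 0) h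
    have e1 := congrArg (fun z : Plane => z 1) h
    simp at e0 e1
    rcases le_total c 1 with h1 | h1
    · exact hy (mem_segment_iff_coord.2 ⟨c, hc.le, h1, by linarith, by linarith⟩)
    · refine hx (mem_segment_iff_coord.2 ⟨1 / c, by positivity, ?_, ?_, ?_⟩)
      · rw [div_le_one hc]; exact h1
      · field_simp; linarith
      · field_simp; linarith

theorem not_mem_openSegment_of_dirNe {a x y z : Plane} (h : DirNe (x - a) (y - a))
    (hx : z ∈ openSegment ℝ a x) : z ∉ openSegment ℝ a y := by
  intro hy
  rw [openSegment_eq_image] at hx hy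
  obtain ⟨s, ⟨hs0, hs1⟩, rfl⟩ := hx
  obtain ⟨t, ⟨ht0, ht1⟩, e⟩ := hy
  refine (dirNe_iff.1 h).2.2 (s / t) (by positivity) ?_
  have e0 := congrArg (fun z : Plane => z 0) e
  have e1 := congrArg (fun z : Plane => z 1) e
  simp at e0 e1
  apply plane_ext <;> simp <;> field_simp <;> linarith

/-- A drawing is planar if cells without a common vertex are disjoint. Unlike the edges in the
definition of a planar drawing, these are compact sets at a positive distance. -/
theorem isPlanarDrawing_of_disjoint {G : SimpleGraph V} {f : V → Plane}
    (h : ∀ u v x y, Cell G u v → Cell G x y → u ≠ x → u ≠ y → v ≠ x → v ≠ y →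
      Disjoint (segment ℝ (f u) (f v)) (segment ℝ (f x) (f y))) : IsPlanarDrawing G f := by
  have hve : ∀ u v w : V, G.Adj u v → w ≠ u → w ≠ v → f w ∉ segment ℝ (f u) (f v) := by
    intro u v w huv h1 h2
    have := h w w u v (Or.inl rfl) (Or.inr huv) h1 h2 h1 h2
    simpa [segment_same] using this
  -- two edges with a common end point have different directions
  have hshare : ∀ a x y, G.Adj a x → G.Adj a y → x ≠ y →
      Disjoint (openSegment ℝ (f a) (f x)) (openSegment ℝ (f a) (f y)) := by
    intro a x y hx hy hxy
    rw [disjoint_left]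
    intro z
    exact not_mem_openSegment_of_dirNe (dirNe_of_not_mem_segment (hve a y x hy hx.ne' hxy)
      (hve a x y hx hy.ne' hxy.symm))
  refine ⟨?_, hve, ?_⟩
  · intro u v huv
    by_contra hne
    have := h u u v v (Or.inl rfl) (Or.inl rfl) hne hne hne hne
    simp [segment_same, huv] at this
  · intro u v x y huv hxy hs
    rw [Ne, Sym2.eq_iff, not_or, not_and_or, not_and_or] at hs
    by_cases h1 : u = x
    · subst h1
      exact hshare u v y huv hxy (by tauto)
    by_cases h2 : u = y
    · subst h2
      rw [openSegment_symm ℝ (f x)]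
      exact hshare u v x huv hxy.symm (by tauto)
    by_cases h3 : v = x
    · subst h3
      rw [openSegment_symm ℝ (f u)]
      exact hshare v u y huv.symm hxy (by tauto)
    by_cases h4 : v = y
    · subst h4
      rw [openSegment_symm ℝ (f u), openSegment_symm ℝ (f x)]
      exact hshare v u x huv.symm hxy.symm (by tauto)
    exact (h u v x y (Or.inr huv) (Or.inr hxy) h1 h2 h3 h4).mono
      (openSegment_subset_segment _ _ _) (openSegment_subset_segment _ _ _)

theorem IsPlanarDrawing.dirNe {G : SimpleGraph V} {f : V → Plane} (h : IsPlanarDrawing G f)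
    {a x y : V} (hx : G.Adj a x) (hy : G.Adj a y) (hxy : x ≠ y) :
    DirNe (f x - f a) (f y - f a) :=
  dirNe_of_not_mem_segment (h.vertex_edge a y x hy hx.ne' hxy)
    (h.vertex_edge a x y hx hy.ne' hxy.symm)

/-- The corners of a triangle of a planar drawing are not collinear. -/
theorem IsPlanarDrawing.orient_ne_zero {G : SimpleGraph V} {f : V → Plane}
    (h : IsPlanarDrawing G f) {u v w : V} (huv : G.Adj u v) (hvw : G.Adj v w) (hwu : G.Adj w u) :
    orient (f u) (f v) (f w) ≠ 0 := by
  intro h0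
  -- otherwise the two edges at `u` are opposite and `u` lies on the third edge
  obtain ⟨c, hc, he⟩ := (h.dirNe huv hwu.symm hvw.ne).exists_neg h0
  apply h.vertex_edge v w u hvw huv.ne hwu.ne'
  have e0 := congrArg (fun z : Plane => z 0) he
  have e1 := congrArg (fun z : Plane => z 1) he
  simp at e0 e1
  refine mem_segment_iff_coord.2 ⟨1 / (1 + c), by positivity, ?_, ?_, ?_⟩
  · rw [div_le_one (by positivity)]; linarith
  · field_simp; linarith
  · field_simp; linarith

/-- Disjointness of segments is an open condition on their end points. -/
theorem eventually_disjoint_segment {X : Type*} [TopologicalSpace X] {x y z w : X → Plane}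
    (hx : Continuous x) (hy : Continuous y) (hz : Continuous z) (hw : Continuous w) {s : X}
    (h : Disjoint (segment ℝ (x s) (y s)) (segment ℝ (z s) (w s))) :
    ∀ᶠ r in 𝓝 s, Disjoint (segment ℝ (x r) (y r)) (segment ℝ (z r) (w r)) := by
  have hK : IsCompact (Icc (0 : ℝ) 1 ×ˢ Icc (0 : ℝ) 1) := isCompact_Icc.prod isCompact_Icc
  have hopen : IsOpen {p : X × (ℝ × ℝ) | (1 - p.2.1) • x p.1 + p.2.1 • y p.1 ≠
      (1 - p.2.2) • z p.1 + p.2.2 • w p.1} :=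
    isOpen_ne_fun (by fun_prop) (by fun_prop)
  have key := hK.eventually_forall_of_forall_eventually (x₀ := s)
    (P := fun r p => (1 - p.1) • x r + p.1 • y r ≠ (1 - p.2) • z r + p.2 • w r) (by
      rintro ⟨α, β⟩ ⟨hα, hβ⟩
      refine hopen.mem_nhds ?_
      intro he
      rw [segment_eq_image, segment_eq_image] at h
      exact disjoint_left.1 h ⟨α, hα, rfl⟩ ⟨β, hβ, he.symm⟩)
  filter_upwards [key] with r hr
  rw [segment_eq_image, segment_eq_image, disjoint_left]
  rintro _ ⟨α, hα, rfl⟩ ⟨β, hβ, he⟩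
  exact hr (α, β) ⟨hα, hβ⟩ he.symm

/-- Planarity is an open condition. -/
theorem IsPlanarDrawing.eventually [Finite V] {G : SimpleGraph V} {X : Type*} [TopologicalSpace X]
    {F : X → V → Plane} (hF : ∀ v, Continuous fun x => F x v) {s : X}
    (h : IsPlanarDrawing G (F s)) : ∀ᶠ r in 𝓝 s, IsPlanarDrawing G (F r) := by
  have : ∀ᶠ r in 𝓝 s, ∀ u v x y, Cell G u v → Cell G x y → u ≠ x → u ≠ y → v ≠ x → v ≠ y →
      Disjoint (segment ℝ (F r u) (F r v)) (segment ℝ (F r x) (F r y)) := by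
    simp only [eventually_all]
    intro u v x y h1 h2 h3 h4 h5 h6
    exact eventually_disjoint_segment (hF u) (hF v) (hF x) (hF y) (h.disjoint h1 h2 h3 h4 h5 h6)
  filter_upwards [this] with r hr
  exact isPlanarDrawing_of_disjoint hr

/-! ### Placing the contracted vertex -/

open Classical in
/-- The drawing of the whole vertex set that puts `p` at `P` and the others as in `f`. -/
noncomputable def place {p : V} (f : {v : V // v ≠ p} → Plane) (P : Plane) : V → Plane :=
  fun v => if h : v = p then P else f ⟨v, h⟩

@[simp]
theorem place_self {p : V} (f : {v : V // v ≠ p} → Plane) (P : Plane) : place f P p = P := by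
  simp [place]

theorem place_of_ne {p : V} (f : {v : V // v ≠ p} → Plane) (P : Plane) {v : V} (h : v ≠ p) :
    place f P v = f ⟨v, h⟩ := by
  simp [place, h]

theorem place_reduce (f : V → Plane) (p : V) : place (reduce f p) (f p) = f := by
  funext v
  by_cases h : v = p
  · subst h; simp
  · rw [place_of_ne _ _ h, reduce]

theorem contractGraph_adj {G : SimpleGraph V} {p a : V} {u v : {v : V // v ≠ p}} :
    (contractGraph G p a).Adj u v ↔ u.1 ≠ v.1 ∧
      (G.Adj u.1 v.1 ∨ (u.1 = a ∧ G.Adj p v.1) ∨ (v.1 = a ∧ G.Adj p u.1)) := by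
  simp only [contractGraph, SimpleGraph.fromRel_adj, ne_eq, Subtype.ext_iff]
  have := G.adj_comm u.1 v.1
  tauto

/-- The neighbours of `p` other than `a`. -/
def linkOf (G : SimpleGraph V) (p a : V) : Set {v : V // v ≠ p} := {n | G.Adj p n.1 ∧ n.1 ≠ a}

/-- The neighbours of `a` other than `p`. -/
def starOf (G : SimpleGraph V) (p a : V) : Set {v : V // v ≠ p} := {x | G.Adj a x.1}

theorem continuous_place {X : Type*} [TopologicalSpace X] {p : V} {F : X → {v : V // v ≠ p} → Plane}
    {P : X → Plane} (hF : ∀ v, Continuous fun x => F x v) (hP : Continuous P) (v : V) :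
    Continuous fun x => place (F x) (P x) v := by
  by_cases h : v = p
  · subst h; simpa using hP
  · simpa [place_of_ne _ _ h] using hF ⟨v, h⟩

theorem isPlanarDrawing_place {G : SimpleGraph V} {p a : V} {f : {v : V // v ≠ p} → Plane}
    {P : Plane} (hf : IsPlanarDrawing (contractGraph G p a) f)
    (h : ∀ v x y, Cell G p v → Cell G x y → p ≠ x → p ≠ y → v ≠ x → v ≠ y →
      Disjoint (segment ℝ P (place f P v)) (segment ℝ (place f P x) (place f P y))) :
    IsPlanarDrawing G (place f P) := by
  have h' : ∀ u v x y, Cell G u v → Cell G x y → p ≠ x → p ≠ y → u ≠ x → u ≠ y → v ≠ x → v ≠ y →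
      Disjoint (segment ℝ (place f P u) (place f P v)) (segment ℝ (place f P x) (place f P y)) := by
    intro u v x y huv hxy hx hy h1 h2 h3 h4
    by_cases hu : u = p
    · subst hu
      simpa using h v x y huv hxy hx hy h3 h4
    by_cases hv : v = p
    · subst hv
      rw [segment_symm ℝ (place f P u)]
      simpa using h u x y huv.symm hxy hx hy h1 h2
    rw [place_of_ne _ _ hu, place_of_ne _ _ hv, place_of_ne _ _ hx.symm, place_of_ne _ _ hy.symm]
    have hcell : ∀ (u v : V) (hu : u ≠ p) (hv : v ≠ p), Cell G u v →
        Cell (contractGraph G p a) ⟨u, hu⟩ ⟨v, hv⟩ := by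
      rintro u v hu hv (rfl | h)
      · exact Or.inl rfl
      · exact Or.inr (contractGraph_adj.2 ⟨h.ne, Or.inl h⟩)
    exact hf.disjoint (hcell _ _ _ _ huv) (hcell _ _ _ _ hxy) (by simpa) (by simpa) (by simpa)
      (by simpa)
  apply isPlanarDrawing_of_disjoint
  intro u v x y huv hxy h1 h2 h3 h4
  by_cases hp : p ≠ x ∧ p ≠ y
  · exact h' u v x y huv hxy hp.1 hp.2 h1 h2 h3 h4
  · refine (h' x y u v hxy huv ?_ ?_ h1.symm h3.symm h2.symm h4.symm).symm
    · rintro rfl; apply hp; exact ⟨h1, h2⟩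
    · rintro rfl; apply hp; exact ⟨h3, h4⟩

/-- Near a point of the family, a vertex `p` placed near its neighbour `a` in a direction that fits
gives a planar drawing: conflicts away from `a` are excluded by planarity of the reduced drawing,
and conflicts at `a` by the choice of the direction. -/
theorem eventually_isPlanarDrawing_place [Finite V] {G : SimpleGraph V} {p a : V} (hpa : G.Adj p a)
    {X : Type*} [TopologicalSpace X] {F : X → {v : V // v ≠ p} → Plane} {q : X → Plane}
    (hF : ∀ v, Continuous fun x => F x v) (hq : Continuous q) (s : X)
    (hs : IsPlanarDrawing (contractGraph G p a) (F s)) :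
    ∀ᶠ z : ℝ × X in 𝓝 (0, s), 0 < z.1 → IsPlanarDrawing (contractGraph G p a) (F z.2) →
      Fits (fun v => F z.2 v - F z.2 ⟨a, hpa.ne'⟩) (linkOf G p a) (starOf G p a) (q z.2) →
      IsPlanarDrawing G (place (F z.2) (F z.2 ⟨a, hpa.ne'⟩ + z.1 • q z.2)) := by
  set A : {v : V // v ≠ p} := ⟨a, hpa.ne'⟩ with hA
  set P : ℝ × X → Plane := fun z => F z.2 A + z.1 • q z.2 with hP
  have hF' : ∀ v, Continuous fun z : ℝ × X => F z.2 v := fun v => (hF v).comp continuous_snd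
  have hPc : Continuous P := (hF' A).add (continuous_fst.smul (hq.comp continuous_snd))
  have hpl := fun v => continuous_place hF' hPc v
  have hcellp : ∀ v (hv : v ≠ p), G.Adj p v → Cell (contractGraph G p a) A ⟨v, hv⟩ := by
    intro v hv h
    by_cases hva : v = a
    · subst hva; exact Or.inl rfl
    · exact Or.inr (contractGraph_adj.2 ⟨fun h => hva h.symm, Or.inr (Or.inl ⟨rfl, h⟩)⟩)
  have hcell : ∀ (u v : V) (hu : u ≠ p) (hv : v ≠ p), Cell G u v →
      Cell (contractGraph G p a) ⟨u, hu⟩ ⟨v, hv⟩ := by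
    rintro u v hu hv (rfl | h)
    · exact Or.inl rfl
    · exact Or.inr (contractGraph_adj.2 ⟨h.ne, Or.inl h⟩)
  have hfar : ∀ᶠ z in 𝓝 ((0 : ℝ), s), ∀ v x y, Cell G p v → Cell G x y → p ≠ x → p ≠ y → v ≠ x →
      v ≠ y → x ≠ a → y ≠ a → Disjoint (segment ℝ (P z) (place (F z.2) (P z) v))
        (segment ℝ (place (F z.2) (P z) x) (place (F z.2) (P z) y)) := by
    simp only [eventually_all]
    intro v x y hpv hxy hpx hpy hvx hvy hxa hya
    refine eventually_disjoint_segment hPc (hpl v) (hpl x) (hpl y) ?_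
    have hP0 : P (0, s) = F s A := by simp [hP]
    rw [hP0, place_of_ne _ _ hpx.symm, place_of_ne _ _ hpy.symm]
    rcases eq_or_ne v p with rfl | hv
    · rw [place_self]
      exact hs.disjoint (Or.inl rfl) (hcell _ _ _ _ hxy) (by simp [hA, hxa.symm])
        (by simp [hA, hya.symm]) (by simp [hA, hxa.symm]) (by simp [hA, hya.symm])
    · rw [place_of_ne _ _ hv]
      exact hs.disjoint (hcellp v hv (hpv.resolve_left hv.symm)) (hcell _ _ _ _ hxy)
        (by simp [hA, hxa.symm]) (by simp [hA, hya.symm]) (by simpa) (by simpa)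
  filter_upwards [hfar] with z hz hz0 hplanar hfit
  apply isPlanarDrawing_place hplanar
  -- the cells at `a`
  have hnear : ∀ v y, Cell G p v → Cell G a y → p ≠ y → v ≠ a → v ≠ y →
      Disjoint (segment ℝ (P z) (place (F z.2) (P z) v))
        (segment ℝ (place (F z.2) (P z) a) (place (F z.2) (P z) y)) := by
    intro v y hpv hay hpy hva hvy
    rw [place_of_ne _ _ hpa.ne', place_of_ne _ _ hpy.symm, ← hA, disjoint_left]
    intro m hm hm'
    obtain ⟨t, ht0, ht1, e0, e1⟩ := mem_segment_iff_coord.1 hm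
    obtain ⟨r, hr0, hr1, e0', e1'⟩ := mem_segment_iff_coord.1 hm'
    -- the position of `y` relative to `a`, and zero when `y = a`
    have hrel : ∀ w : Plane, place (F z.2) (P z) v = F z.2 A + w →
        r • (F z.2 ⟨y, hpy.symm⟩ - F z.2 A) = ((1 - t) * z.1) • q z.2 + t • w := by
      intro w hw
      rw [hw] at e0 e1
      simp only [hP, PiLp.add_apply, PiLp.smul_apply, smul_eq_mul] at e0 e1
      apply plane_ext <;> simp <;> linarith
    have hqz := hfit.ne_zero
    have hstar : y ≠ a → (⟨y, hpy.symm⟩ : {v : V // v ≠ p}) ∈ starOf G p a :=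
      fun h => hay.resolve_left h.symm
    rcases eq_or_ne v p with rfl | hv
    · have h1 := hrel (z.1 • q z.2) (by simp [hP])
      have h2 : r • (F z.2 ⟨y, hpy.symm⟩ - F z.2 A) = z.1 • q z.2 := by
        rw [h1, smul_smul, ← add_smul]; congr 1; ring
      have h3 : z.1 • q z.2 ≠ 0 := smul_ne_zero hz0.ne' hqz
      rcases hr0.eq_or_lt with hr | hr
      · rw [← hr, zero_smul] at h2; exact h3 h2.symm
      rcases eq_or_ne y a with rfl | hya
      · rw [← hA, sub_self, smul_zero] at h2; exact h3 h2.symm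
      · refine hfit.off _ (hstar hya) (z.1 / r) (by positivity) ?_
        rw [← inv_smul_smul₀ hr.ne' (F z.2 ⟨y, hpy.symm⟩ - F z.2 A), h2, smul_smul]
        congr 1; field_simp
    · have hN : (⟨v, hv⟩ : {v : V // v ≠ p}) ∈ linkOf G p a := ⟨hpv.resolve_left hv.symm, hva⟩
      have h1 := hrel (F z.2 ⟨v, hv⟩ - F z.2 A) (by rw [place_of_ne _ _ hv]; abel)
      -- if the left-hand side vanishes then `v` is opposite to `q`
      have hzero : r • (F z.2 ⟨y, hpy.symm⟩ - F z.2 A) ≠ 0 := by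
        intro h0
        rw [h0] at h1
        rcases ht0.eq_or_lt with ht | ht
        · rw [← ht] at h1
          simp only [sub_zero, one_mul, zero_smul, add_zero] at h1
          exact smul_ne_zero hz0.ne' hqz h1.symm
        rcases ht1.eq_or_lt with ht' | ht'
        · rw [ht'] at h1
          simp only [sub_self, zero_mul, zero_smul, zero_add, one_smul] at h1
          have h6 : v = a := congrArg Subtype.val (hplanar.injective (sub_eq_zero.1 h1.symm))
          exact hva h6
        · have h4 : 0 < 1 - t := by linarith
          refine hfit.opposite _ hN ((1 - t) * z.1 / t) (by positivity) ?_
          have h5 : t • (F z.2 ⟨v, hv⟩ - F z.2 A) = -(((1 - t) * z.1) • q z.2) :=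
            eq_neg_iff_add_eq_zero.2 (by rw [h1, add_comm])
          rw [← inv_smul_smul₀ ht.ne' (F z.2 ⟨v, hv⟩ - F z.2 A), h5, ← neg_smul, smul_smul]
          congr 1; field_simp
      have hr : 0 < r := by
        rcases hr0.eq_or_lt with hr | hr
        · rw [← hr, zero_smul] at hzero; exact absurd rfl hzero
        · exact hr
      have hya : y ≠ a := by
        rintro rfl
        rw [← hA, sub_self, smul_zero] at hzero; exact absurd rfl hzero
      have hY : F z.2 ⟨y, hpy.symm⟩ - F z.2 A = ((1 - t) * z.1 / r) • q z.2
          + (t / r) • (F z.2 ⟨v, hv⟩ - F z.2 A) := by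
        rw [← inv_smul_smul₀ hr.ne' (F z.2 ⟨y, hpy.symm⟩ - F z.2 A), h1, smul_add, smul_smul,
          smul_smul]
        congr 2 <;> field_simp
      rcases ht0.eq_or_lt with ht | ht
      · refine hfit.off _ (hstar hya) (z.1 / r) (by positivity) ?_
        rw [hY, ← ht]; simp
      rcases ht1.eq_or_lt with ht' | ht'
      · -- two edges at `a` of the reduced graph in the same direction
        have hd := hplanar.dirNe (a := A) (x := ⟨v, hv⟩) (y := ⟨y, hpy.symm⟩)
          ((hcellp v hv (hpv.resolve_left hv.symm)).resolve_left
            (fun h => hva (congrArg Subtype.val h).symm))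
          ((hcell a y hpa.ne' hpy.symm hay).resolve_left
            (fun h => hya (congrArg Subtype.val h).symm)) (by simpa using hvy)
        refine (dirNe_iff.1 hd).2.2 (1 / r) (by positivity) ?_
        rw [hY, ht']; simp
      · have h4 : 0 < 1 - t := by linarith
        exact hfit.between _ hN _ (hstar hya) (by simpa using hvy) _ _ (by positivity)
          (by positivity) hY
  intro v x y hpv hxy hpx hpy hvx hvy
  by_cases hxa : x = a
  · subst hxa
    exact hnear v y hpv hxy hpy hvx hvy
  by_cases hya : y = a
  · subst hya
    rw [segment_symm ℝ (place (F z.2) (F z.2 A + z.1 • q z.2) x)]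
    exact hnear v x hpv hxy.symm hpx hvy hvx
  exact hz v x y hpv hxy hpx hpy hvx hvy hxa hya

/-- Along a compact family of planar drawings of the reduced graph, one distance works. -/
theorem exists_isPlanarDrawing_place [Finite V] {G : SimpleGraph V} {p a : V} (hpa : G.Adj p a)
    {F : ℝ → {v : V // v ≠ p} → Plane} {q : ℝ → Plane}
    (hF : ∀ v, Continuous fun x => F x v) (hq : Continuous q)
    (hs : ∀ t ∈ Icc (0 : ℝ) 1, IsPlanarDrawing (contractGraph G p a) (F t))
    (hfit : ∀ t ∈ Icc (0 : ℝ) 1,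
      Fits (fun v => F t v - F t ⟨a, hpa.ne'⟩) (linkOf G p a) (starOf G p a) (q t)) :
    ∃ δ₀ : ℝ, 0 < δ₀ ∧ ∀ δ, 0 < δ → δ < δ₀ → ∀ t ∈ Icc (0 : ℝ) 1,
      IsPlanarDrawing G (place (F t) (F t ⟨a, hpa.ne'⟩ + δ • q t)) := by
  have := isCompact_Icc.eventually_forall_of_forall_eventually (x₀ := (0 : ℝ))
    (P := fun δ t => 0 < δ → IsPlanarDrawing (contractGraph G p a) (F t) →
      Fits (fun v => F t v - F t ⟨a, hpa.ne'⟩) (linkOf G p a) (starOf G p a) (q t) →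
      IsPlanarDrawing G (place (F t) (F t ⟨a, hpa.ne'⟩ + δ • q t))) (fun t ht =>
      eventually_isPlanarDrawing_place hpa hF hq t (hs t ht))
  obtain ⟨δ₀, h0, h⟩ := Metric.eventually_nhds_iff.1 this
  refine ⟨δ₀, h0, fun δ hδ hδ' t ht => h ?_ t ht hδ (hs t ht) (hfit t ht)⟩
  rw [Real.dist_eq, sub_zero, abs_of_pos hδ]
  exact hδ'

/-- Conversely, the direction of a vertex that can be moved arbitrarily close to `a` fits. -/
theorem fits_of_isPlanarDrawing [Finite V] {G : SimpleGraph V} {p a : V} (hpa : G.Adj p a)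
    {f : {v : V // v ≠ p} → Plane} {q : Plane} (h : ∀ δ₀ : ℝ, 0 < δ₀ → ∃ δ, 0 < δ ∧ δ < δ₀ ∧
      IsPlanarDrawing G (place f (f ⟨a, hpa.ne'⟩ + δ • q))) :
    Fits (fun v => f v - f ⟨a, hpa.ne'⟩) (linkOf G p a) (starOf G p a) q := by
  set A : {v : V // v ≠ p} := ⟨a, hpa.ne'⟩ with hA
  constructor
  · rintro rfl
    obtain ⟨δ, -, -, hp⟩ := h 1 one_pos
    refine hpa.ne (hp.injective ?_)
    rw [place_self, place_of_ne _ _ hpa.ne', ← hA]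
    simp
  · rintro ⟨x, hx⟩ hax α hα he
    obtain ⟨δ, hδ, hδα, hp⟩ := h α hα
    have hne : p ≠ x := hx.symm
    refine hp.vertex_edge a x p hax hpa.ne hne ?_
    rw [place_self, place_of_ne _ _ hpa.ne', place_of_ne _ _ hx, ← hA, sub_eq_iff_eq_add.1 he]
    refine mem_segment_iff_coord.2 ⟨δ / α, by positivity, (div_le_one hα).2 hδα.le, ?_, ?_⟩ <;>
      simp <;> field_simp <;> ring
  · rintro ⟨n, hn⟩ ⟨hpn, hna⟩ α hα he
    obtain ⟨δ, hδ, -, hp⟩ := h 1 one_pos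
    refine hp.vertex_edge p n a hpn hpa.ne' (Ne.symm hna) ?_
    rw [place_self, place_of_ne _ _ hpa.ne', place_of_ne _ _ hn, ← hA, sub_eq_iff_eq_add.1 he]
    refine mem_segment_iff_coord.2 ⟨δ / (δ + α), by positivity, ?_, ?_, ?_⟩
    · rw [div_le_one (by positivity)]; linarith
    · simp; field_simp; ring
    · simp; field_simp; ring
  · rintro ⟨n, hn⟩ ⟨hpn, hna⟩ ⟨x, hx⟩ hax hnx α β hα hβ he
    have hax : G.Adj a x := hax
    simp only at hna hpn
    obtain ⟨δ, hδ, hδα, hp⟩ := h α hα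
    have hd := hp.disjoint (Or.inr hpn) (Or.inr hax) hpa.ne hx.symm hna (by simpa using hnx)
    rw [place_self, place_of_ne _ _ hpa.ne', place_of_ne _ _ hx, place_of_ne _ _ hn, ← hA,
      sub_eq_iff_eq_add.1 he, disjoint_left] at hd
    -- the point where the two segments cross, at ratio `δ / (α + β δ)` on the segment at `a`
    have hD : 0 < α + β * δ := by positivity
    have hm : f A + (δ / (α + β * δ)) • (α • q + β • (f ⟨n, hn⟩ - f A)) ∈
        segment ℝ (f A) (α • q + β • (f ⟨n, hn⟩ - f A) + f A) := by
      refine mem_segment_iff_coord.2 ⟨δ / (α + β * δ), by positivity, ?_, ?_, ?_⟩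
      · rw [div_le_one hD]; nlinarith [mul_pos hβ hδ]
      · simp; ring
      · simp; ring
    refine hd (mem_segment_iff_coord.2 ⟨β * δ / (α + β * δ), by positivity, ?_, ?_, ?_⟩) hm
    · rw [div_le_one hD]; linarith
    · simp; field_simp; ring
    · simp; field_simp; ring

/-! ### Triangles of a triangulation -/

/-- `u v w` is a counterclockwise triangle of the graph without vertices in its interior. -/
structure IsEmptyTriangle (G : SimpleGraph V) (f : V → Plane) (u v w : V) : Prop where
  adj₁ : G.Adj u v
  adj₂ : G.Adj v w
  adj₃ : G.Adj w u
  pos : 0 < orient (f u) (f v) (f w)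
  empty : ∀ s, ¬ InTriangle (f u) (f v) (f w) (f s)

/-- `u v w` is a counterclockwise triangle of the graph with all other vertices in its interior. -/
structure IsOuterTriangle (G : SimpleGraph V) (f : V → Plane) (u v w : V) : Prop where
  adj₁ : G.Adj u v
  adj₂ : G.Adj v w
  adj₃ : G.Adj w u
  pos : 0 < orient (f u) (f v) (f w)
  inside : ∀ s, s ≠ u → s ≠ v → s ≠ w → InTriangle (f u) (f v) (f w) (f s)

/-- The combinatorial form of a triangulated drawing: to the left of every directed edge there is
an empty triangle, or else the outer face, whose boundary triangle encloses all vertices. In this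
form the property passes to the drawings that planar morphs and contractions lead to. -/
structure IsTriangulation (G : SimpleGraph V) (f : V → Plane) : Prop where
  planar : IsPlanarDrawing G f
  left : ∀ u v, G.Adj u v → (∃ w, IsEmptyTriangle G f u v w) ∨ ∃ w, IsOuterTriangle G f v u w

theorem IsEmptyTriangle.rotate {G : SimpleGraph V} {f : V → Plane} {u v w : V}
    (h : IsEmptyTriangle G f u v w) : IsEmptyTriangle G f v w u :=
  ⟨h.adj₂, h.adj₃, h.adj₁, orient_rotate (f u) (f v) (f w) ▸ h.pos,
    fun s hs => h.empty s hs.rotate.rotate⟩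

theorem IsOuterTriangle.rotate {G : SimpleGraph V} {f : V → Plane} {u v w : V}
    (h : IsOuterTriangle G f u v w) : IsOuterTriangle G f v w u :=
  ⟨h.adj₂, h.adj₃, h.adj₁, orient_rotate (f u) (f v) (f w) ▸ h.pos,
    fun s h1 h2 h3 => (h.inside s h3 h1 h2).rotate⟩

theorem not_inTriangle_left (x y z : Plane) : ¬ InTriangle x y z x := by
  intro h
  have := h.1
  simp [orient_eq] at this

theorem not_inTriangle_of_eq {x y z s : Plane} (h : s = x ∨ s = y ∨ s = z) :
    ¬ InTriangle x y z s := by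
  rcases h with rfl | rfl | rfl
  · exact not_inTriangle_left _ _ _
  · exact fun h => not_inTriangle_left _ _ _ h.rotate
  · exact fun h => not_inTriangle_left _ _ _ h.rotate.rotate

theorem IsOuterTriangle.orient_nonneg {G : SimpleGraph V} {f : V → Plane} {u v w : V}
    (h : IsOuterTriangle G f u v w) (s : V) : 0 ≤ orient (f u) (f v) (f s) := by
  by_cases h1 : s = u
  · subst h1; simp [orient_eq]
  by_cases h2 : s = v
  · subst h2; rw [orient_eq]; nlinarith
  by_cases h3 : s = w
  · subst h3; exact h.pos.le
  exact (h.inside s h1 h2 h3).1.le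

/-- In a planar drawing the other vertices are off the sides of a triangle. -/
theorem IsPlanarDrawing.off_triangle {G : SimpleGraph V} {f : V → Plane} (h : IsPlanarDrawing G f)
    {u v w s : V} (h1 : G.Adj u v) (h2 : G.Adj v w) (h3 : G.Adj w u) (hu : s ≠ u) (hv : s ≠ v)
    (hw : s ≠ w) : f s ∉ segment ℝ (f u) (f v) ∧ f s ∉ segment ℝ (f v) (f w) ∧
      f s ∉ segment ℝ (f w) (f u) :=
  ⟨h.vertex_edge u v s h1 hu hv, h.vertex_edge v w s h2 hv hw, h.vertex_edge w u s h3 hw hu⟩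

theorem continuous_linearMorph (f g : V → Plane) (v : V) :
    Continuous fun t => linearMorph f g t v := by
  unfold linearMorph
  simp only [AffineMap.lineMap_apply_module]
  fun_prop

theorem linearMorph_zero (f g : V → Plane) : linearMorph f g 0 = f := by
  funext v; simp [linearMorph]

theorem linearMorph_one (f g : V → Plane) : linearMorph f g 1 = g := by
  funext v; simp [linearMorph]

theorem IsPlanarStep.right {G : SimpleGraph V} {f g : V → Plane} (h : IsPlanarStep G f g) :
    IsPlanarDrawing G g :=
  linearMorph_one f g ▸ h 1 ⟨zero_le_one, le_rfl⟩

/-- A triangle keeps its orientation in a planar morph. -/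
theorem IsPlanarStep.orient_pos {G : SimpleGraph V} {f g : V → Plane} (h : IsPlanarStep G f g)
    {u v w : V} (h1 : G.Adj u v) (h2 : G.Adj v w) (h3 : G.Adj w u)
    (h0 : 0 < orient (f u) (f v) (f w)) : ∀ t ∈ Icc (0 : ℝ) 1,
      0 < orient (linearMorph f g t u) (linearMorph f g t v) (linearMorph f g t w) := by
  refine pos_of_ne_zero (m := fun t => orient (linearMorph f g t u) (linearMorph f g t v)
    (linearMorph f g t w)) ?_ (fun t ht => (h t ht).orient_ne_zero h1 h2 h3) ?_
  · exact Continuous.orient (continuous_linearMorph f g u) (continuous_linearMorph f g v)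
      (continuous_linearMorph f g w)
  · simpa only [linearMorph_zero] using h0

/-- No vertex moves through a side of a triangle in a planar morph. -/
theorem IsPlanarStep.inTriangle_iff {G : SimpleGraph V} {f g : V → Plane} (h : IsPlanarStep G f g)
    {u v w s : V} (h1 : G.Adj u v) (h2 : G.Adj v w) (h3 : G.Adj w u)
    (h0 : 0 < orient (f u) (f v) (f w)) (hu : s ≠ u) (hv : s ≠ v) (hw : s ≠ w) :
    InTriangle (f u) (f v) (f w) (f s) ↔ InTriangle (g u) (g v) (g w) (g s) := by
  have := inTriangle_path (continuous_linearMorph f g u) (continuous_linearMorph f g v)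
    (continuous_linearMorph f g w) (continuous_linearMorph f g s) (h.orient_pos h1 h2 h3 h0)
    (fun t ht => (h t ht).off_triangle h1 h2 h3 hu hv hw) 1 ⟨zero_le_one, le_rfl⟩
  simpa only [linearMorph_zero, linearMorph_one] using this

theorem IsEmptyTriangle.step {G : SimpleGraph V} {f g : V → Plane} (h : IsPlanarStep G f g)
    {u v w : V} (hw : IsEmptyTriangle G f u v w) : IsEmptyTriangle G g u v w := by
  refine ⟨hw.adj₁, hw.adj₂, hw.adj₃, ?_, fun s => ?_⟩
  · simpa only [linearMorph_one] using
      h.orient_pos hw.adj₁ hw.adj₂ hw.adj₃ hw.pos 1 ⟨zero_le_one, le_rfl⟩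
  · by_cases hs : s = u ∨ s = v ∨ s = w
    · refine not_inTriangle_of_eq ?_
      rcases hs with rfl | rfl | rfl <;> simp
    · push Not at hs
      exact fun h' => hw.empty s
        ((h.inTriangle_iff hw.adj₁ hw.adj₂ hw.adj₃ hw.pos hs.1 hs.2.1 hs.2.2).2 h')

theorem IsOuterTriangle.step {G : SimpleGraph V} {f g : V → Plane} (h : IsPlanarStep G f g)
    {u v w : V} (hw : IsOuterTriangle G f u v w) : IsOuterTriangle G g u v w := by
  refine ⟨hw.adj₁, hw.adj₂, hw.adj₃, ?_, fun s h1 h2 h3 => ?_⟩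
  · simpa only [linearMorph_one] using
      h.orient_pos hw.adj₁ hw.adj₂ hw.adj₃ hw.pos 1 ⟨zero_le_one, le_rfl⟩
  · exact (h.inTriangle_iff hw.adj₁ hw.adj₂ hw.adj₃ hw.pos h1 h2 h3).1 (hw.inside s h1 h2 h3)

theorem IsTriangulation.step {G : SimpleGraph V} {f g : V → Plane} (hf : IsTriangulation G f)
    (h : IsPlanarStep G f g) : IsTriangulation G g :=
  ⟨h.right, fun u v huv => (hf.left u v huv).imp (fun ⟨w, hw⟩ => ⟨w, hw.step h⟩)
    fun ⟨w, hw⟩ => ⟨w, hw.step h⟩⟩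

/-- A vertex with a supporting line of the drawing is a boundary vertex: the open half-plane beyond
the line lies in the outer face. -/
theorem isBoundaryVertex_of_halfPlane {G : SimpleGraph V} {f : V → Plane} {p : V} {d : Plane}
    (hd : d ≠ 0) (h : ∀ v, cross d (f v - f p) ≤ 0) : IsBoundaryVertex G f p := by
  set S : Set Plane := {x | 0 < cross d (x - f p)} with hS
  have hconv : Convex ℝ S := by
    intro x hx y hy a b ha hb hab
    simp only [hS, mem_ofPred_eq] at hx hy ⊢
    have : cross d (a • x + b • y - f p) = a * cross d (x - f p) + b * cross d (y - f p) := by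
      have hb' : b = 1 - a := by linarith
      subst hb'
      simp [cross]; ring
    rw [this]
    rcases ha.eq_or_lt with rfl | ha
    · have : b = 1 := by linarith
      subst this; simpa using hy
    · have := mul_pos ha hx
      have := mul_nonneg hb hy.le
      linarith
  have hsub : S ⊆ (drawnSet G f)ᶜ := by
    rintro x hx (⟨v, rfl⟩ | ⟨u, v, -, hm⟩)
    · exact absurd hx (not_lt.2 (h v))
    · obtain ⟨t, h0, h1, e0, e1⟩ := mem_segment_iff_coord.1 hm
      have : cross d (x - f p) = (1 - t) * cross d (f u - f p) + t * cross d (f v - f p) := by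
        simp [cross, e0, e1]; ring
      simp only [hS, mem_ofPred_eq, this] at hx
      nlinarith [h u, h v]
  -- the normal direction of the line
  set n : Plane := !₂[-d 1, d 0] with hn
  have hdn : 0 < cross d n := by
    have : cross d n = d 0 ^ 2 + d 1 ^ 2 := by simp [cross, hn]; ring
    rw [this]
    exact (eq_smul_of_cross_eq_zero hd (cross_self d)).1
  have hray : ∀ s : ℝ, 0 < s → f p + s • n ∈ S := by
    intro s hs
    simp only [hS, mem_ofPred_eq, add_sub_cancel_left, cross_smul_right]
    positivity
  have hn0 : n ≠ 0 := by rintro h0; rw [h0] at hdn; simp [cross] at hdn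
  have hSF : S ⊆ connectedComponentIn (drawnSet G f)ᶜ (f p + (1 : ℝ) • n) :=
    hconv.isPreconnected.subset_connectedComponentIn (hray 1 one_pos) hsub
  refine ⟨_, ⟨f p + (1 : ℝ) • n, hsub (hray 1 one_pos), rfl⟩, ?_, ?_⟩
  · intro hb
    obtain ⟨R, hR⟩ := Metric.isBounded_iff.1 (hb.subset hSF)
    have hnn : 0 < ‖n‖ := norm_pos_iff.2 hn0
    have h1 := hR (hray 1 one_pos) (hray (1 + (|R| + 1) / ‖n‖) (by positivity))
    rw [dist_eq_norm, add_sub_add_left_eq_sub, ← sub_smul, norm_smul] at h1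
    have h2 : ‖1 - (1 + (|R| + 1) / ‖n‖)‖ * ‖n‖ = |R| + 1 := by
      rw [Real.norm_eq_abs, sub_add_cancel_left, abs_neg, abs_of_pos (by positivity)]
      field_simp
    rw [h2] at h1
    linarith [le_abs_self R]
  · have hcl : f p ∈ closure S := by
      have ht : Tendsto (fun s : ℝ => f p + s • n) (𝓝[>] 0) (𝓝 (f p)) := by
        have : Tendsto (fun s : ℝ => f p + s • n) (𝓝 0) (𝓝 (f p + (0 : ℝ) • n)) :=
          Continuous.tendsto (by fun_prop) 0
        rw [zero_smul, add_zero] at this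
        exact this.mono_left nhdsWithin_le_nhds
      exact mem_closure_of_tendsto ht (eventually_mem_nhdsWithin.mono fun s hs => hray s hs)
    refine ⟨closure_mono hSF hcl, fun hi => ?_⟩
    exact connectedComponentIn_subset _ _ (interior_subset hi) (Or.inl ⟨p, rfl⟩)

theorem IsOuterTriangle.isBoundaryVertex {G : SimpleGraph V} {f : V → Plane} {u v w : V}
    (hf : IsPlanarDrawing G f) (h : IsOuterTriangle G f u v w) : IsBoundaryVertex G f u := by
  refine isBoundaryVertex_of_halfPlane (d := f u - f v)
    (sub_ne_zero.2 fun e => h.adj₁.ne (hf.injective e)) fun s => ?_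
  have := h.orient_nonneg s
  have e : cross (f u - f v) (f s - f u) = - orient (f u) (f v) (f s) := by
    simp [cross, orient_eq]; ring
  linarith

/-- Both sides of an edge at an inner vertex carry empty triangles. -/
theorem IsTriangulation.exists_isEmptyTriangle {G : SimpleGraph V} {f : V → Plane}
    (hf : IsTriangulation G f) {p v : V} (hp : ¬ IsBoundaryVertex G f p) (h : G.Adj p v) :
    (∃ w, IsEmptyTriangle G f p v w) ∧ ∃ w, IsEmptyTriangle G f v p w := by
  constructor
  · refine (hf.left p v h).resolve_right ?_
    rintro ⟨w, hw⟩
    exact hp (hw.rotate.isBoundaryVertex hf.planar)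
  · refine (hf.left v p h.symm).resolve_right ?_
    rintro ⟨w, hw⟩
    exact hp (hw.isBoundaryVertex hf.planar)

/-! ### Contractions of triangulations -/

/-- Contraction of `p` to `a` turns an empty triangle at `p` into an empty triangle at `a`. -/
theorem IsEmptyTriangle.contract {G : SimpleGraph V} {f : V → Plane} {p a v w : V}
    (hc : IsPlanarContraction G f p a) (h : IsEmptyTriangle G f v w p)
    (hap : a ≠ p) (hv : v ≠ p) (hw : w ≠ p) (hva : v ≠ a) (hwa : w ≠ a) :
    IsEmptyTriangle (contractGraph G p a) (reduce f p) ⟨v, hv⟩ ⟨w, hw⟩ ⟨a, hap⟩ := by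
  classical
  have adj₁ : (contractGraph G p a).Adj ⟨v, hv⟩ ⟨w, hw⟩ :=
    contractGraph_adj.2 ⟨h.adj₁.ne, Or.inl h.adj₁⟩
  have adj₂ : (contractGraph G p a).Adj ⟨w, hw⟩ ⟨a, hap⟩ :=
    contractGraph_adj.2 ⟨hwa, Or.inr (Or.inr ⟨rfl, h.adj₂.symm⟩)⟩
  have adj₃ : (contractGraph G p a).Adj ⟨a, hap⟩ ⟨v, hv⟩ :=
    contractGraph_adj.2 ⟨hva.symm, Or.inr (Or.inl ⟨rfl, h.adj₃⟩)⟩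
  set P : ℝ → Plane := fun t => AffineMap.lineMap (f p) (f a) t with hP
  have hPc : Continuous P := AffineMap.lineMap_continuous
  have hFp : ∀ t, linearMorph f (Function.update f p (f a)) t p = P t := by
    intro t; simp [linearMorph, hP]
  have hFv : ∀ t x, x ≠ p → linearMorph f (Function.update f p (f a)) t x = f x := by
    intro t x hx; simp [linearMorph, hx]
  have hP0 : P 0 = f p := by simp [hP]
  have hP1 : P 1 = f a := by simp [hP]
  have hpos : ∀ t ∈ Icc (0 : ℝ) 1, 0 < orient (f v) (f w) (P t) := by
    refine pos_of_ne_zero (m := fun t => orient (f v) (f w) (P t)) (by fun_prop) ?_ ?_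
    · intro t ht
      rcases ht.2.lt_or_eq with h1 | rfl
      · have := (hc.before t ⟨ht.1, h1⟩).orient_ne_zero h.adj₁ h.adj₂ h.adj₃
        rwa [hFp, hFv _ _ hv, hFv _ _ hw] at this
      · rw [hP1]
        exact hc.after.orient_ne_zero adj₁ adj₂ adj₃
    · rw [hP0]; exact h.pos
  refine ⟨adj₁, adj₂, adj₃, by simpa [hP1, reduce] using hpos 1 ⟨zero_le_one, le_rfl⟩, ?_⟩
  rintro ⟨s, hs⟩ hin
  by_cases hsc : s = v ∨ s = w ∨ s = a
  · refine not_inTriangle_of_eq ?_ hin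
    rcases hsc with rfl | rfl | rfl <;> simp
  push Not at hsc
  have := inTriangle_path (u := fun _ => f v) (v := fun _ => f w) (w := P) (s := fun _ => f s)
    continuous_const continuous_const hPc continuous_const hpos (by
      intro t ht
      rcases ht.2.lt_or_eq with h1 | rfl
      · have := (hc.before t ⟨ht.1, h1⟩).off_triangle h.adj₁ h.adj₂ h.adj₃ hsc.1 hsc.2.1 hs
        rwa [hFp, hFv _ _ hv, hFv _ _ hw, hFv _ _ hs] at this
      · rw [hP1]
        exact hc.after.off_triangle (s := ⟨s, hs⟩) adj₁ adj₂ adj₃ (by simpa using hsc.1)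
          (by simpa using hsc.2.1) (by simpa using hsc.2.2)) 1 ⟨zero_le_one, le_rfl⟩
  rw [hP0, hP1] at this
  exact h.empty s (this.2 hin)

/-- An outer triangle does not contain an inner vertex `p` and survives the contraction of `p`. -/
theorem IsOuterTriangle.contract {G : SimpleGraph V} {f : V → Plane} {p a u v w : V}
    (hf : IsPlanarDrawing G f) (hp : ¬ IsBoundaryVertex G f p) (hw : IsOuterTriangle G f u v w)
    (hu : u ≠ p) (hv : v ≠ p) :
    ∃ w, IsOuterTriangle (contractGraph G p a) (reduce f p) ⟨u, hu⟩ ⟨v, hv⟩ w := by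
  have hwp : w ≠ p := by
    rintro rfl
    exact hp (hw.rotate.rotate.isBoundaryVertex hf)
  have hlift : ∀ {u v : {v : V // v ≠ p}}, G.Adj u.1 v.1 → (contractGraph G p a).Adj u v :=
    fun h => contractGraph_adj.2 ⟨h.ne, Or.inl h⟩
  exact ⟨⟨w, hwp⟩, hlift hw.adj₁, hlift hw.adj₂, hlift hw.adj₃, hw.pos,
    fun s h1 h2 h3 => hw.inside s.1 (fun h => h1 (Subtype.ext h)) (fun h => h2 (Subtype.ext h))
      (fun h => h3 (Subtype.ext h))⟩

theorem IsTriangulation.contract {G : SimpleGraph V} {f : V → Plane} {p a : V}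
    (hf : IsTriangulation G f) (hpa : G.Adj p a) (hc : IsPlanarContraction G f p a) :
    IsTriangulation (contractGraph G p a) (reduce f p) := by
  have hap := hpa.ne'
  have hinner := fun v (h : G.Adj p v) => hf.exists_isEmptyTriangle hc.nonboundary h
  have hlift : ∀ {u v : {v : V // v ≠ p}}, G.Adj u.1 v.1 → (contractGraph G p a).Adj u v :=
    fun h => contractGraph_adj.2 ⟨h.ne, Or.inl h⟩
  refine ⟨hc.after, ?_⟩
  rintro ⟨u, hu⟩ ⟨v, hv⟩ huv
  -- an edge from `a` to a neighbour of `p` inherits the triangle of the edge from `p`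
  have hfrom : ∀ (v : V) (hv : v ≠ p), v ≠ a → ∀ w, w ≠ a → IsEmptyTriangle G f p v w →
      ∃ w, IsEmptyTriangle (contractGraph G p a) (reduce f p) ⟨a, hap⟩ ⟨v, hv⟩ w := by
    intro v hv hva w hwa hw
    exact ⟨_, (hw.rotate.contract hc hap hv hw.adj₃.ne hva hwa).rotate.rotate⟩
  have hto : ∀ (v : V) (hv : v ≠ p), v ≠ a → ∀ w, w ≠ a → IsEmptyTriangle G f v p w →
      ∃ w, IsEmptyTriangle (contractGraph G p a) (reduce f p) ⟨v, hv⟩ ⟨a, hap⟩ w := by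
    intro v hv hva w hwa hw
    exact ⟨_, (hw.rotate.rotate.contract hc hap hw.adj₂.ne' hv hwa hva).rotate⟩
  by_cases hadj : G.Adj u v
  · rcases hf.left u v hadj with ⟨w, hw⟩ | ⟨w, hw⟩
    · left
      by_cases hwp : w = p
      · subst hwp
        by_cases hua : u = a
        · subst hua
          obtain ⟨w₂, h₂⟩ := (hinner v hw.adj₂.symm).1
          refine hfrom v hv hadj.ne' w₂ ?_ h₂
          rintro rfl
          have h3 := h₂.pos
          have h4 := hw.pos
          linarith [orient_rotate (f w) (f v) (f w₂), orient_swap (f w₂) (f v) (f w)]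
        by_cases hva : v = a
        · subst hva
          obtain ⟨w₂, h₂⟩ := (hinner u hw.adj₃).2
          refine hto u hu hadj.ne w₂ ?_ h₂
          rintro rfl
          have h3 := h₂.pos
          have h4 := hw.pos
          linarith [orient_swap (f w) (f u) (f w₂), orient_rotate (f w) (f u) (f w₂)]
        exact ⟨_, hw.contract hc hap hu hv hua hva⟩
      · refine ⟨⟨w, hwp⟩, hlift hw.adj₁, hlift hw.adj₂, hlift hw.adj₃, hw.pos, fun s => hw.empty s⟩
    · exact Or.inr (hw.contract hf.planar hc.nonboundary hv hu)
  · left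
    rcases (contractGraph_adj.1 huv).2 with h | ⟨h, h'⟩ | ⟨h, h'⟩
    · exact absurd h hadj
    · obtain rfl : u = a := h
      obtain ⟨w, hw⟩ := (hinner v h').1
      refine hfrom v hv (contractGraph_adj.1 huv).1.symm w ?_ hw
      rintro rfl
      exact hadj hw.adj₂.symm
    · obtain rfl : v = a := h
      obtain ⟨w, hw⟩ := (hinner u h').2
      refine hto u hu (contractGraph_adj.1 huv).1 w ?_ hw
      rintro rfl
      exact hadj hw.adj₃.symm

/-! ### Sequences of steps -/

/-- The linear morph from `f` to `g` is planar and unidirectional. -/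
def IsMorphStep (G : SimpleGraph V) (f g : V → Plane) : Prop :=
  IsPlanarStep G f g ∧ IsUnidirectionalStep f g

/-- There is a morph from `f` to `h` that consists of `n` planar unidirectional steps. -/
def HasMorph (G : SimpleGraph V) : ℕ → (V → Plane) → (V → Plane) → Prop
  | 0, f, h => f = h
  | n + 1, f, h => ∃ g, IsMorphStep G f g ∧ HasMorph G n g h

theorem HasMorph.trans {G : SimpleGraph V} {m n : ℕ} {f g h : V → Plane} (h1 : HasMorph G m f g)
    (h2 : HasMorph G n g h) : HasMorph G (m + n) f h := by
  induction m generalizing f with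
  | zero => obtain rfl : f = g := h1; simpa using h2
  | succ m ih =>
    obtain ⟨f', hs, h1⟩ := h1
    rw [Nat.succ_add_eq_add_succ]
    exact ⟨f', hs, ih h1⟩

theorem IsMorphStep.hasMorph {G : SimpleGraph V} {f g : V → Plane} (h : IsMorphStep G f g) :
    HasMorph G 1 f g :=
  ⟨g, h, rfl⟩

theorem HasMorph.invariant {G : SimpleGraph V} {P : (V → Plane) → Prop}
    (hP : ∀ f g, IsPlanarStep G f g → P f → P g) {n : ℕ} {f g : V → Plane} (h : HasMorph G n f g)
    (hf : P f) : P g := by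
  induction n generalizing f with
  | zero => obtain rfl : f = g := h; exact hf
  | succ n ih =>
    obtain ⟨f', hs, h⟩ := h
    exact ih h (hP _ _ hs.1 hf)

theorem HasMorph.exists_fin {G : SimpleGraph V} {n : ℕ} {f h : V → Plane} (hm : HasMorph G n f h) :
    ∃ Γ : Fin (n + 1) → V → Plane, Γ 0 = f ∧ Γ (Fin.last n) = h ∧
      ∀ i : Fin n, IsMorphStep G (Γ i.castSucc) (Γ i.succ) := by
  induction n generalizing f with
  | zero => exact ⟨fun _ => f, rfl, hm, fun i => i.elim0⟩
  | succ n ih =>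
    obtain ⟨g, hs, hm⟩ := hm
    obtain ⟨Γ, h0, h1, h2⟩ := ih hm
    refine ⟨Fin.cons f Γ, rfl, ?_, ?_⟩
    · rw [← Fin.succ_last, Fin.cons_succ, h1]
    · intro i
      induction i using Fin.cases with
      | zero => simpa [h0] using hs
      | succ i => simpa [← Fin.succ_castSucc] using h2 i

/-! ### Keeping the contracted vertex close to its neighbour -/

theorem linearMorph_place {p : V} (f g : {v : V // v ≠ p} → Plane) (P Q : Plane) (t : ℝ) :
    linearMorph (place f P) (place g Q) t =
      place (linearMorph f g t) (AffineMap.lineMap P Q t) := by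
  funext v
  by_cases h : v = p
  · subst h; simp [linearMorph]
  · simp [linearMorph, place_of_ne _ _ h]

/-- A step that moves a single vertex is unidirectional. -/
theorem isUnidirectionalStep_place {p : V} (f : {v : V // v ≠ p} → Plane) (P Q : Plane) :
    IsUnidirectionalStep (place f P) (place f Q) := by
  by_cases h : Q = P
  · subst h
    exact ⟨EuclideanSpace.single 0 1, by simp, fun v => ⟨0, by simp⟩⟩
  · have h0 : ‖Q - P‖ ≠ 0 := norm_ne_zero_iff.2 (sub_ne_zero.2 h)
    refine ⟨‖Q - P‖⁻¹ • (Q - P), by rw [norm_smul, norm_inv, norm_norm, inv_mul_cancel₀ h0],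
      fun v => ?_⟩
    by_cases hv : v = p
    · subst hv
      exact ⟨‖Q - P‖, by rw [smul_inv_smul₀ h0]; simp⟩
    · exact ⟨0, by simp [place_of_ne _ _ hv]⟩

theorem contractGraph_adj_of_mem {G : SimpleGraph V} {p a : V} (hap : a ≠ p)
    {i : {v : V // v ≠ p}} (hi : i ∈ linkOf G p a ∪ starOf G p a) :
    (contractGraph G p a).Adj ⟨a, hap⟩ i := by
  rcases hi with hi | hi
  · exact contractGraph_adj.2 ⟨fun h => hi.2 h.symm, Or.inr (Or.inl ⟨rfl, hi.1⟩)⟩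
  · have hi : G.Adj a i.1 := hi
    exact contractGraph_adj.2 ⟨hi.ne, Or.inl hi⟩

theorem dirNe_of_mem {G : SimpleGraph V} {p a : V} (hap : a ≠ p) {f : {v : V // v ≠ p} → Plane}
    (hf : IsPlanarDrawing (contractGraph G p a) f) :
    ∀ i ∈ linkOf G p a ∪ starOf G p a, ∀ j ∈ linkOf G p a ∪ starOf G p a, i ≠ j →
      DirNe (f i - f ⟨a, hap⟩) (f j - f ⟨a, hap⟩) :=
  fun _ hi _ hj hij => hf.dirNe (contractGraph_adj_of_mem hap hi)
    (contractGraph_adj_of_mem hap hj) hij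

/-- The rotation at `a` in the drawing `f` of the reduced graph: the edges inherited from `p` and
the edges of `a` occupy complementary sectors, bounded by the edges to `b` and `e`. -/
abbrev FanAt (G : SimpleGraph V) {p a : V} (hap : a ≠ p) (f : {v : V // v ≠ p} → Plane)
    (b e : {v : V // v ≠ p}) : Prop :=
  Fan (fun v => f v - f ⟨a, hap⟩) (linkOf G p a) (starOf G p a) b e

/-- The rotation at `a` does not change in a planar morph. -/
theorem FanAt.linearMorph {G : SimpleGraph V} {p a : V} {hap : a ≠ p}
    {f g : {v : V // v ≠ p} → Plane} {b e : {v : V // v ≠ p}} (h : FanAt G hap f b e)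
    (hb : b ∈ starOf G p a) (he : e ∈ starOf G p a) (hbe : b ≠ e)
    (hs : IsPlanarStep (contractGraph G p a) f g) :
    ∀ t ∈ Icc (0 : ℝ) 1, FanAt G hap (linearMorph f g t) b e := by
  have hc : ∀ v, Continuous fun t =>
      PlanarMorph.linearMorph f g t v - PlanarMorph.linearMorph f g t ⟨a, hap⟩ := fun v =>
    (continuous_linearMorph f g v).sub (continuous_linearMorph f g _)
  intro t ht
  constructor
  · intro n hn hnb hne
    refine cyc_path (hc b) (hc n) (hc e) (fun s hs' => ?_) ?_ t ht
    · have := dirNe_of_mem hap (hs s hs')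
      exact ⟨this _ (Or.inr hb) _ (Or.inl hn) hnb.symm, this _ (Or.inl hn) _ (Or.inr he) hne,
        this _ (Or.inr he) _ (Or.inr hb) hbe.symm⟩
    · simpa only [linearMorph_zero] using h.inner n hn hnb hne
  · intro n hn hnb hne
    refine cyc_path (hc b) (hc e) (hc n) (fun s hs' => ?_) ?_ t ht
    · have := dirNe_of_mem hap (hs s hs')
      exact ⟨this _ (Or.inr hb) _ (Or.inr he) hbe, this _ (Or.inr he) _ (Or.inr hn) hne.symm,
        this _ (Or.inr hn) _ (Or.inr hb) hnb⟩
    · simpa only [linearMorph_zero] using h.outer n hn hnb hne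

/-- A step of the reduced graph lifts to a step of the graph, with `p` close to `a`. -/
theorem exists_isMorphStep_place [Finite V] {G : SimpleGraph V} {p a : V} (hpa : G.Adj p a)
    {f g : {v : V // v ≠ p} → Plane} {b e : {v : V // v ≠ p}} (h : FanAt G hpa.ne' f b e)
    (hb : b ∈ starOf G p a) (he : e ∈ starOf G p a) (hbe : b ≠ e)
    (hs : IsMorphStep (contractGraph G p a) f g) {q : Plane}
    (hq : InSector (f b - f ⟨a, hpa.ne'⟩) (f e - f ⟨a, hpa.ne'⟩) q) :
    ∃ q', InSector (g b - g ⟨a, hpa.ne'⟩) (g e - g ⟨a, hpa.ne'⟩) q' ∧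
      ∃ δ₀ : ℝ, 0 < δ₀ ∧ ∀ δ, 0 < δ → δ < δ₀ →
        IsMorphStep G (place f (f ⟨a, hpa.ne'⟩ + δ • q)) (place g (g ⟨a, hpa.ne'⟩ + δ • q')) := by
  set A : {v : V // v ≠ p} := ⟨a, hpa.ne'⟩ with hA
  obtain ⟨hplan, l, hl, hc⟩ := hs
  choose c hc using hc
  have hrel : ∀ v t, linearMorph f g t v - linearMorph f g t A =
      f v - f A + (t * (c v - c A)) • l := by
    intro v t
    simp only [linearMorph, AffineMap.lineMap_apply_module, hc]
    module
  have hrel1 : ∀ v, g v - g A = f v - f A + (c v - c A) • l := by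
    intro v; rw [hc, hc]; module
  obtain ⟨s, hsec⟩ := exists_inSector_of_unidirectional (l := l) (β := c b - c A) (γ := c e - c A)
    hq (fun t ht => by
      rw [← hrel, ← hrel]
      exact dirNe_of_mem hpa.ne' (hplan t ht) _ (Or.inr hb) _ (Or.inr he) hbe)
  rw [← hrel1, ← hrel1] at hsec
  refine ⟨q + s • l, hsec, ?_⟩
  obtain ⟨δ₀, h0, hδ⟩ := exists_isPlanarDrawing_place hpa (F := fun t => linearMorph f g t)
    (q := fun t => q + (t * s) • l) (continuous_linearMorph f g) (by fun_prop) hplan (by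
      intro t ht
      refine Fits.of_fan (h.linearMorph hb he hbe hplan t ht) ?_
      rw [← hA, hrel, hrel]
      -- the two determinants are affine in `t` because `b`, `e` and `q` move parallel to `l`
      have e1 : cross (f b - f A + (t * (c b - c A)) • l) (q + (t * s) • l) =
          (1 - t) * cross (f b - f A) q + t * cross (g b - g A) (q + s • l) := by
        rw [hrel1]; simp [cross]; ring
      have e2 : cross (q + (t * s) • l) (f e - f A + (t * (c e - c A)) • l) =
          (1 - t) * cross q (f e - f A) + t * cross (q + s • l) (g e - g A) := by
        rw [hrel1]; simp [cross]; ring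
      have comb : ∀ x y : ℝ, 0 < x → 0 < y → 0 < (1 - t) * x + t * y := by
        intro x y hx hy
        rcases ht.1.eq_or_lt with rfl | h0
        · simpa using hx
        · have := mul_nonneg (sub_nonneg.2 ht.2) hx.le
          have := mul_pos h0 hy
          linarith
      exact ⟨e1 ▸ comb _ _ hq.1 hsec.1, e2 ▸ comb _ _ hq.2 hsec.2⟩)
  refine ⟨δ₀, h0, fun δ hδ0 hδ1 => ⟨fun t ht => ?_, l, hl, fun v => ?_⟩⟩
  · rw [linearMorph_place]
    convert hδ δ hδ0 hδ1 t ht using 2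
    simp only [linearMorph, AffineMap.lineMap_apply_module]
    module
  · by_cases hv : v = p
    · subst hv
      refine ⟨c A + δ * s, ?_⟩
      rw [place_self, place_self, hc]
      module
    · exact ⟨c ⟨v, hv⟩, by rw [place_of_ne _ _ hv, place_of_ne _ _ hv, hc]⟩

/-- A morph of the reduced graph lifts to a morph of the graph with as many steps. -/
theorem exists_hasMorph_place [Finite V] {G : SimpleGraph V} {p a : V} (hpa : G.Adj p a) {n : ℕ}
    {f g : {v : V // v ≠ p} → Plane} {b e : {v : V // v ≠ p}} (h : FanAt G hpa.ne' f b e)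
    (hb : b ∈ starOf G p a) (he : e ∈ starOf G p a) (hbe : b ≠ e)
    (hs : HasMorph (contractGraph G p a) n f g) {q : Plane}
    (hq : InSector (f b - f ⟨a, hpa.ne'⟩) (f e - f ⟨a, hpa.ne'⟩) q) :
    FanAt G hpa.ne' g b e ∧
    ∃ q', InSector (g b - g ⟨a, hpa.ne'⟩) (g e - g ⟨a, hpa.ne'⟩) q' ∧
      ∃ δ₀ : ℝ, 0 < δ₀ ∧ ∀ δ, 0 < δ → δ < δ₀ →
        HasMorph G n (place f (f ⟨a, hpa.ne'⟩ + δ • q)) (place g (g ⟨a, hpa.ne'⟩ + δ • q')) := by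
  induction n generalizing f q with
  | zero =>
    obtain rfl : f = g := hs
    exact ⟨h, q, hq, 1, one_pos, fun _ _ _ => rfl⟩
  | succ n ih =>
    obtain ⟨f', hs, hm⟩ := hs
    obtain ⟨q₁, hq₁, δ₁, h1, hδ₁⟩ := exists_isMorphStep_place hpa h hb he hbe hs hq
    have h' := h.linearMorph hb he hbe hs.1 1 ⟨zero_le_one, le_rfl⟩
    rw [linearMorph_one] at h'
    obtain ⟨hg, q', hq', δ₂, h2, hδ₂⟩ := ih h' hm hq₁
    refine ⟨hg, q', hq', min δ₁ δ₂, lt_min h1 h2, fun δ h0 hδ => ?_⟩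
    exact ⟨_, hδ₁ δ h0 (hδ.trans_le (min_le_left _ _)), hδ₂ δ h0 (hδ.trans_le (min_le_right _ _))⟩

theorem IsPlanarContraction.isPlanarDrawing_place {G : SimpleGraph V} {f : V → Plane} {p a : V}
    (h : IsPlanarContraction G f p a) {δ : ℝ} (h0 : 0 < δ) (h1 : δ ≤ 1) :
    IsPlanarDrawing G (place (reduce f p) (f a + δ • (f p - f a))) := by
  have := h.before (1 - δ) ⟨by linarith, by linarith⟩
  convert this using 1
  funext v
  by_cases hv : v = p
  · subst hv
    simp only [place_self, linearMorph, Function.update_self, AffineMap.lineMap_apply_module]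
    module
  · simp [place_of_ne _ _ hv, linearMorph, hv, reduce]

theorem IsPlanarContraction.fits [Finite V] {G : SimpleGraph V} {f : V → Plane} {p a : V}
    (hpa : G.Adj p a) (h : IsPlanarContraction G f p a) :
    Fits (fun v => reduce f p v - reduce f p ⟨a, hpa.ne'⟩) (linkOf G p a) (starOf G p a)
      (f p - f a) := by
  refine fits_of_isPlanarDrawing hpa fun δ₀ h0 => ⟨min (δ₀ / 2) 1, ?_, ?_, ?_⟩
  · positivity
  · exact (min_le_left _ _).trans_lt (by linarith)
  · exact h.isPlanarDrawing_place (by positivity) (min_le_right _ _)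

/-- The contraction of `p`, stopped shortly before it reaches `a`. -/
theorem IsPlanarContraction.isMorphStep {G : SimpleGraph V} {f : V → Plane} {p a : V}
    (h : IsPlanarContraction G f p a) {δ : ℝ} (h0 : 0 < δ) (h1 : δ ≤ 1) :
    IsMorphStep G f (place (reduce f p) (f a + δ • (f p - f a))) := by
  refine ⟨fun t ht => ?_, ?_⟩
  · have h2 : 0 < 1 - t + t * δ := by
      rcases ht.1.eq_or_lt with rfl | h3
      · simp
      · have := mul_pos h3 h0
        linarith [ht.2]
    have h3 : 1 - t + t * δ ≤ 1 := by nlinarith [ht.1]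
    have hlm := linearMorph_place (reduce f p) (reduce f p) (f p) (f a + δ • (f p - f a)) t
    rw [place_reduce] at hlm
    rw [hlm]
    convert h.isPlanarDrawing_place h2 h3 using 2
    · funext v; simp [linearMorph]
    · simp only [AffineMap.lineMap_apply_module]
      module
  · have := isUnidirectionalStep_place (reduce f p) (f p) (f a + δ • (f p - f a))
    rwa [place_reduce] at this

/-- The uncontraction of `p`, started at a point close to `a` in the correct sector. Early on `p`
is close to `a` in a direction that fits, and later it is close to its positions in the given
uncontraction. -/
theorem IsPlanarContraction.exists_isMorphStep [Finite V] {G : SimpleGraph V} {g : V → Plane}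
    {p a : V} (hpa : G.Adj p a) (h : IsPlanarContraction G g p a) {b e : {v : V // v ≠ p}}
    (hfan : FanAt G hpa.ne' (reduce g p) b e) {q : Plane}
    (hq : InSector (g b - g a) (g e - g a) q)
    (hq' : InSector (g b - g a) (g e - g a) (g p - g a)) :
    ∃ δ₀ : ℝ, 0 < δ₀ ∧ ∀ δ, 0 < δ → δ < δ₀ →
      IsMorphStep G (place (reduce g p) (g a + δ • q)) g := by
  set r := g p - g a with hr
  obtain ⟨δ₁, h1, hδ₁⟩ := exists_isPlanarDrawing_place hpa (F := fun _ => reduce g p)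
    (q := fun t => (1 - t) • q + t • r) (fun v => continuous_const) (by fun_prop)
    (fun t ht => h.after) (by
      intro t ht
      refine Fits.of_fan hfan ?_
      have comb : ∀ x y : ℝ, 0 < x → 0 < y → 0 < (1 - t) * x + t * y := by
        intro x y hx hy
        rcases ht.1.eq_or_lt with rfl | h0
        · simpa using hx
        · have := mul_nonneg (sub_nonneg.2 ht.2) hx.le
          have := mul_pos h0 hy
          linarith
      constructor
      · rw [cross_add_right, cross_smul_right, cross_smul_right]
        exact comb _ _ hq.1 hq'.1
      · rw [cross_add_left, cross_smul_left, cross_smul_left]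
        exact comb _ _ hq.2 hq'.2)
  have hlate : ∀ᶠ δ in 𝓝 (0 : ℝ), ∀ t ∈ Icc (δ₁ / 2) 1,
      IsPlanarDrawing G (place (reduce g p) (g a + (((1 - t) * δ) • q + t • r))) := by
    refine isCompact_Icc.eventually_forall_of_forall_eventually (P := fun δ t =>
      IsPlanarDrawing G (place (reduce g p) (g a + (((1 - t) * δ) • q + t • r)))) ?_
    intro t ht
    refine IsPlanarDrawing.eventually (s := ((0 : ℝ), t)) (F := fun z : ℝ × ℝ =>
      place (reduce g p) (g a + (((1 - z.2) * z.1) • q + z.2 • r))) ?_ ?_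
    · exact continuous_place (fun v => continuous_const) (by fun_prop)
    · have := h.isPlanarDrawing_place (δ := t) (by linarith [ht.1]) ht.2
      simpa using this
  obtain ⟨δ₂, h2, hδ₂⟩ := Metric.eventually_nhds_iff.1 hlate
  refine ⟨min (δ₁ / 2) δ₂, lt_min (by linarith) h2, fun δ h0 hδ => ⟨fun t ht => ?_, ?_⟩⟩
  · have hδa := hδ.trans_le (min_le_left _ _)
    have hδb := hδ.trans_le (min_le_right _ _)
    have hpos : IsPlanarDrawing G (place (reduce g p) (g a + (((1 - t) * δ) • q + t • r))) := by
      rcases le_total (δ₁ / 2) t with htt | htt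
      · exact hδ₂ (by rw [Real.dist_eq, sub_zero, abs_of_pos h0]; exact hδb) t ⟨htt, ht.2⟩
      · set ρ := (1 - t) * δ + t with hρ
        have i1 : 0 ≤ (1 - t) * δ := mul_nonneg (sub_nonneg.2 ht.2) h0.le
        have hρ0 : 0 < ρ := by
          rcases ht.1.eq_or_lt with rfl | h3
          · simpa [hρ] using h0
          · linarith
        have hρ1 : ρ < δ₁ := by nlinarith [ht.1]
        have := hδ₁ ρ hρ0 hρ1 (t / ρ)
          ⟨div_nonneg ht.1 hρ0.le, (div_le_one hρ0).2 (by linarith)⟩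
        have e : ρ • ((1 - t / ρ) • q + (t / ρ) • r) = ((1 - t) * δ) • q + t • r := by
          rw [smul_add, smul_smul, smul_smul]
          congr 2
          · field_simp; linarith
          · field_simp
        rw [e] at this
        exact this
    have hlm := linearMorph_place (reduce g p) (reduce g p) (g a + δ • q) (g p) t
    rw [place_reduce] at hlm
    rw [hlm]
    convert hpos using 2
    · funext v; simp [linearMorph]
    · simp only [AffineMap.lineMap_apply_module, hr]
      module
  · have := isUnidirectionalStep_place (reduce g p) (g a + δ • q) (g p)
    rwa [place_reduce] at this

/-! ### Replacing a contraction and its uncontraction -/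

/-- The direction of `p` from `a` before the uncontraction lies in the same sector as before the
contraction. If it lay in the opposite sector, the rotation at `a` would force `p` and `a` to have
no neighbours besides each other and the apexes `b` and `e`; then `a b e` is the outer triangle, and
`p` would have been uncontracted through its corner `a` to the outside. -/
theorem inSector_of_uncontraction [Finite V] {G : SimpleGraph V} {f g : V → Plane} {p a : V}
    (hpa : G.Adj p a) (hf : IsTriangulation G f) (hcf : IsPlanarContraction G f p a)
    (hcg : IsPlanarContraction G g p a) {n : ℕ}
    (hm : HasMorph (contractGraph G p a) n (reduce f p) (reduce g p)) {b e : V}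
    (hb : IsEmptyTriangle G f p a b) (he : IsEmptyTriangle G f a p e) (hbp : b ≠ p) (hep : e ≠ p)
    (hbe : b ≠ e) (hfan : FanAt G hpa.ne' (reduce g p) ⟨b, hbp⟩ ⟨e, hep⟩) :
    InSector (g b - g a) (g e - g a) (g p - g a) := by
  have hfit := hcg.fits hpa
  have hbN : (⟨b, hbp⟩ : {v : V // v ≠ p}) ∈ linkOf G p a := ⟨hb.adj₃.symm, hb.adj₂.ne'⟩
  have hbA : (⟨b, hbp⟩ : {v : V // v ≠ p}) ∈ starOf G p a := hb.adj₂
  have heN : (⟨e, hep⟩ : {v : V // v ≠ p}) ∈ linkOf G p a := ⟨he.adj₂, he.adj₃.ne⟩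
  have heA : (⟨e, hep⟩ : {v : V // v ≠ p}) ∈ starOf G p a := he.adj₃.symm
  have hbe' : (⟨b, hbp⟩ : {v : V // v ≠ p}) ≠ ⟨e, hep⟩ := by simpa using hbe
  have hdir := dirNe_of_mem hpa.ne' hcg.after
  have hdb := hdir _ (Or.inl hbN) _ (Or.inl heN) hbe'
  have hor := inSector_or_inSector hdb
    (dirNe_iff.2 ⟨hfit.ne_zero, hdb.left_ne_zero, hfit.off _ hbA⟩)
    (dirNe_iff.2 ⟨hfit.ne_zero, hdb.symm.left_ne_zero, hfit.off _ heA⟩)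
    (hfit.opposite _ hbN) (hfit.opposite _ heN)
    (hfit.between _ heN _ hbA hbe'.symm) (hfit.between _ hbN _ heA hbe')
  rcases hor with hor | hor
  · exact hor
  exfalso
  have hfan' : FanAt G hpa.ne' (reduce g p) ⟨e, hep⟩ ⟨b, hbp⟩ :=
    Fan.of_fits hfit hor ⟨heN, heA⟩ ⟨hbN, hbA⟩ hdir
  have hN : ∀ v, G.Adj p v → v = a ∨ v = b ∨ v = e := by
    intro v hv
    by_contra hn
    push Not at hn
    have hvN : (⟨v, hv.ne'⟩ : {v : V // v ≠ p}) ∈ linkOf G p a := ⟨hv, hn.1⟩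
    exact (hfan.inner _ hvN (by simpa using hn.2.1) (by simpa using hn.2.2)).not_rev
      (hfan'.inner _ hvN (by simpa using hn.2.2) (by simpa using hn.2.1))
  have hA : ∀ v, G.Adj a v → v = p ∨ v = b ∨ v = e := by
    intro v hv
    by_contra hn
    push Not at hn
    have hvA : (⟨v, hn.1⟩ : {v : V // v ≠ p}) ∈ starOf G p a := hv
    exact (hfan.outer _ hvA (by simpa using hn.2.1) (by simpa using hn.2.2)).not_rev
      (hfan'.outer _ hvA (by simpa using hn.2.2) (by simpa using hn.2.1)).rotate.rotate
  have o1 := hb.pos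
  have o2 := he.pos
  -- the third triangle at `p` is `p b e`, so `p` lies inside `a b e`
  have o3 : 0 < orient (f p) (f b) (f e) := by
    obtain ⟨w, hw⟩ := (hf.exists_isEmptyTriangle hcf.nonboundary hb.adj₃.symm).1
    have h1 := hw.pos
    rcases hN w hw.adj₃.symm with rfl | rfl | rfl
    · linarith [orient_swap (f p) (f b) (f w), orient_rotate (f b) (f p) (f w),
        orient_rotate (f p) (f w) (f b)]
    · exact absurd rfl hw.adj₂.ne
    · exact h1
  have o4 : 0 < orient (f a) (f b) (f e) := by
    have : orient (f a) (f b) (f e) = orient (f p) (f a) (f b) + orient (f p) (f b) (f e) +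
        orient (f a) (f p) (f e) := by
      simp only [orient_eq]; ring
    linarith
  obtain ⟨w₁, h₁⟩ : ∃ w, IsOuterTriangle G f a b w := by
    refine (hf.left b a hb.adj₂.symm).resolve_left ?_
    rintro ⟨w, hw⟩
    have h1 := hw.pos
    rcases hA w hw.adj₂ with rfl | rfl | rfl
    · linarith [orient_swap (f a) (f b) (f w), orient_rotate (f w) (f a) (f b)]
    · exact hw.adj₃.ne rfl
    · linarith [orient_swap (f a) (f b) (f w)]
  obtain ⟨w₂, h₂⟩ : ∃ w, IsOuterTriangle G f e a w := by
    refine (hf.left a e he.adj₃.symm).resolve_left ?_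
    rintro ⟨w, hw⟩
    have h1 := hw.pos
    rcases hA w hw.adj₃.symm with rfl | rfl | rfl
    · linarith [orient_swap (f e) (f a) (f w), orient_rotate (f e) (f a) (f w)]
    · linarith [orient_swap (f e) (f a) (f w), orient_rotate (f e) (f a) (f w)]
    · exact hw.adj₂.ne rfl
  obtain ⟨x₁, k₁⟩ := h₁.contract (a := a) hf.planar hcf.nonboundary hpa.ne' hbp
  obtain ⟨x₂, k₂⟩ := h₂.contract (a := a) hf.planar hcf.nonboundary hep hpa.ne'
  have k₁' := hm.invariant (P := fun d => IsOuterTriangle _ d _ _ _) (fun _ _ hs h => h.step hs) k₁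
  have k₂' := hm.invariant (P := fun d => IsOuterTriangle _ d _ _ _) (fun _ _ hs h => h.step hs) k₂
  -- in `g` the line through `p` parallel to `b e` supports the drawing
  have hpos : 0 < cross (g e - g b) (g p - g a) := by
    have h1 : 0 < cross (g e - g a) (g p - g a) := hor.1
    have h2 : 0 < cross (g p - g a) (g b - g a) := hor.2
    have h3 : cross (g e - g b) (g p - g a) =
        cross (g e - g a) (g p - g a) + cross (g p - g a) (g b - g a) := by
      simp [cross]; ring
    linarith
  refine hcg.nonboundary (isBoundaryVertex_of_halfPlane (d := g e - g b) ?_ fun v => ?_)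
  · intro h0
    rw [h0] at hpos
    simp [cross] at hpos
  · by_cases hv : v = p
    · subst hv; simp [cross]
    · have h1 : 0 ≤ orient (g a) (g b) (g v) := k₁'.orient_nonneg ⟨v, hv⟩
      have h2 : 0 ≤ orient (g e) (g a) (g v) := k₂'.orient_nonneg ⟨v, hv⟩
      have h3 : cross (g e - g b) (g v - g p) = -(orient (g a) (g b) (g v) +
          orient (g e) (g a) (g v) + cross (g e - g b) (g p - g a)) := by
        simp [cross, orient_eq]; ring
      linarith

/-- A contraction, a morph of the reduced graph and the uncontraction can be replaced by a morph
with as many steps. -/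
theorem hasMorph_of_contraction [Finite V] {G : SimpleGraph V} {f g : V → Plane} {p a : V}
    (hpa : G.Adj p a) (hf : IsTriangulation G f) (hcf : IsPlanarContraction G f p a)
    (hcg : IsPlanarContraction G g p a) {n : ℕ}
    (hm : HasMorph (contractGraph G p a) n (reduce f p) (reduce g p)) :
    HasMorph G (1 + n + 1) f g := by
  obtain ⟨⟨b, hb⟩, ⟨e, he⟩⟩ := hf.exists_isEmptyTriangle hcf.nonboundary hpa
  have hbp : b ≠ p := hb.adj₃.ne
  have hep : e ≠ p := he.adj₂.ne'
  have hbe : b ≠ e := by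
    rintro rfl
    linarith [hb.pos, he.pos, orient_swap (f p) (f a) (f b)]
  have hbN : (⟨b, hbp⟩ : {v : V // v ≠ p}) ∈ linkOf G p a := ⟨hb.adj₃.symm, hb.adj₂.ne'⟩
  have hbA : (⟨b, hbp⟩ : {v : V // v ≠ p}) ∈ starOf G p a := hb.adj₂
  have heN : (⟨e, hep⟩ : {v : V // v ≠ p}) ∈ linkOf G p a := ⟨he.adj₂, he.adj₃.ne⟩
  have heA : (⟨e, hep⟩ : {v : V // v ≠ p}) ∈ starOf G p a := he.adj₃.symm
  have hbe' : (⟨b, hbp⟩ : {v : V // v ≠ p}) ≠ ⟨e, hep⟩ := by simpa using hbe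
  have hq : InSector (f b - f a) (f e - f a) (f p - f a) := by
    have h1 := hb.pos
    rw [← orient_rotate] at h1
    exact ⟨h1, he.pos⟩
  have hfan : FanAt G hpa.ne' (reduce f p) ⟨b, hbp⟩ ⟨e, hep⟩ :=
    Fan.of_fits (hcf.fits hpa) hq ⟨hbN, hbA⟩ ⟨heN, heA⟩ (dirNe_of_mem hpa.ne' hcf.after)
  obtain ⟨hfan', q, hq', δ₁, h1, hδ₁⟩ := exists_hasMorph_place hpa hfan hbA heA hbe' hm hq
  have hr := inSector_of_uncontraction hpa hf hcf hcg hm hb he hbp hep hbe hfan'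
  obtain ⟨δ₂, h2, hδ₂⟩ := hcg.exists_isMorphStep hpa hfan' hq' hr
  obtain ⟨δ, h0, hδ⟩ := exists_between (lt_min (lt_min h1 h2) one_pos)
  have l1 : δ < δ₁ := hδ.trans_le ((min_le_left _ _).trans (min_le_left _ _))
  have l2 : δ < δ₂ := hδ.trans_le ((min_le_left _ _).trans (min_le_right _ _))
  have l3 : δ ≤ 1 := (hδ.trans_le (min_le_right _ _)).le
  exact ((hcf.isMorphStep h0 l3).hasMorph.trans (hδ₁ δ h0 l1)).trans (hδ₂ δ h0 l2).hasMorph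

/-- Pseudo-morphs of triangulations can be replaced by morphs with as many steps. -/
theorem PseudoMorph.hasMorph {G : SimpleGraph V} {f h : V → Plane} (M : PseudoMorph G f h)
    (hV : Finite V) (hf : IsTriangulation G f) (hp : M.IsPlanar) (hu : M.IsUnidirectional) :
    HasMorph G M.numSteps f h := by
  induction M with
  | nil G f => exact rfl
  | linear f g h rest ih =>
    rw [numSteps, add_comm]
    exact ⟨g, ⟨hp.1, hu.1⟩, ih hV (hf.step hp.1) hp.2 hu.2⟩
  | contract f g h p a hpa inner rest ih₁ ih₂ =>
    obtain ⟨hcf, hi, hcg, hr⟩ := hp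
    have hm := hasMorph_of_contraction hpa hf hcf hcg
      (ih₁ inferInstance (hf.contract hpa hcf) hi hu.1)
    exact hm.trans (ih₂ hV (hm.invariant (fun _ _ hs h => h.step hs) hf) hr hu.2)

/-! ### Faces of a triangulated drawing -/

/-- A connected set that meets a set but not its frontier lies inside. -/
theorem subset_of_disjoint_frontier {X : Type*} [TopologicalSpace X]
    {s t : Set X} (hs : IsPreconnected s) (h : (s ∩ t).Nonempty) (hd : Disjoint s (frontier t)) :
    s ⊆ t := by
  have hcover : s ⊆ interior t ∪ (closure t)ᶜ := by
    intro x hx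
    by_cases hc : x ∈ closure t
    · by_contra hn
      exact disjoint_left.1 hd hx ⟨hc, fun hi => hn (Or.inl hi)⟩
    · exact Or.inr hc
  obtain ⟨x, hx, hxt⟩ := h
  exact (hs.subset_left_of_subset_union isOpen_interior isClosed_closure.isOpen_compl
    (disjoint_left.2 fun _ hi hc => hc (subset_closure (interior_subset hi))) hcover
    ⟨x, hx, (hcover hx).resolve_right fun hc => hc (subset_closure hxt)⟩).trans interior_subset

/-- The boundary of a triangle. -/
def triangleBoundary (x y z : Plane) : Set Plane :=
  segment ℝ x y ∪ segment ℝ y z ∪ segment ℝ z x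

theorem triangleBoundary_rotate (x y z : Plane) :
    triangleBoundary y z x = triangleBoundary x y z := by
  unfold triangleBoundary
  rw [union_comm, union_assoc]

theorem triangleBoundary_swap (x y z : Plane) :
    triangleBoundary y x z = triangleBoundary x y z := by
  unfold triangleBoundary
  rw [segment_symm ℝ y x, segment_symm ℝ x z, segment_symm ℝ z y, union_right_comm]

theorem convex_orient_pos (x y : Plane) : Convex ℝ {s | 0 < orient x y s} := by
  intro s hs t ht a b ha hb hab
  simp only [mem_ofPred_eq] at hs ht ⊢
  have : orient x y (a • s + b • t) = a * orient x y s + b * orient x y t := by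
    have hb' : b = 1 - a := by linarith
    subst hb'
    simp [orient_eq]; ring
  rw [this]
  rcases ha.eq_or_lt with rfl | ha
  · have : b = 1 := by linarith
    subst this; simpa using ht
  · have := mul_pos ha hs
    have := mul_nonneg hb ht.le
    linarith

theorem isPreconnected_inTriangle (x y z : Plane) : IsPreconnected {s | InTriangle x y z s} :=
  ((convex_orient_pos x y).inter
    ((convex_orient_pos y z).inter (convex_orient_pos z x))).isPreconnected

theorem orient_nonneg_of_mem_triangleBoundary {x y z s : Plane} (h : 0 < orient x y z)
    (hs : s ∈ triangleBoundary x y z) :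
    0 ≤ orient x y s ∧ 0 ≤ orient y z s ∧ 0 ≤ orient z x s := by
  have h2 : 0 < orient y z x := by rwa [orient_rotate]
  have h3 : 0 < orient z x y := by rwa [orient_rotate]
  rcases hs with (hs | hs) | hs
  · obtain ⟨t, h0, h1, e1, e2, e3⟩ := orient_of_mem_segment z hs
    exact ⟨e1.ge, e2 ▸ mul_nonneg (by linarith) h.le, e3 ▸ mul_nonneg h0 h.le⟩
  · obtain ⟨t, h0, h1, e1, e2, e3⟩ := orient_of_mem_segment x hs
    exact ⟨e3 ▸ mul_nonneg h0 h2.le, e1.ge, e2 ▸ mul_nonneg (by linarith) h2.le⟩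
  · obtain ⟨t, h0, h1, e1, e2, e3⟩ := orient_of_mem_segment y hs
    exact ⟨e2 ▸ mul_nonneg (by linarith) h3.le, e3 ▸ mul_nonneg h0 h3.le, e1.ge⟩

theorem not_inTriangle_of_mem_triangleBoundary {x y z s : Plane}
    (hs : s ∈ triangleBoundary x y z) : ¬ InTriangle x y z s := by
  rintro ⟨h1, h2, h3⟩
  rcases hs with (hs | hs) | hs
  · obtain ⟨t, -, -, e, -⟩ := orient_of_mem_segment z hs
    exact h1.ne' e
  · obtain ⟨t, -, -, e, -⟩ := orient_of_mem_segment x hs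
    exact h2.ne' e
  · obtain ⟨t, -, -, e, -⟩ := orient_of_mem_segment y hs
    exact h3.ne' e

/-- The outside of a triangle is connected, as the union of three overlapping half-planes. -/
theorem isPreconnected_outside {x y z : Plane} (h : 0 < orient x y z) :
    IsPreconnected {s | orient x y s < 0 ∨ orient y z s < 0 ∨ orient z x s < 0} := by
  have hneg : ∀ u v : Plane, {s | orient u v s < 0} = {s | 0 < orient v u s} := by
    intro u v; ext s
    simp only [mem_ofPred_eq]
    rw [orient_swap, neg_lt_zero]
  have hpre : ∀ u v : Plane, IsPreconnected {s | orient u v s < 0} := by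
    intro u v
    rw [hneg]
    exact (convex_orient_pos _ _).isPreconnected
  -- continuing both sides at a corner beyond it leads into the overlap of two half-planes
  have e1 : orient x y (2 • y - z + (y - x)) < 0 ∧ orient y z (2 • y - z + (y - x)) < 0 := by
    have a1 : orient x y (2 • y - z + (y - x)) = -orient x y z := by
      simp [orient_eq]; ring
    have a2 : orient y z (2 • y - z + (y - x)) = -orient x y z := by
      simp [orient_eq]; ring
    constructor <;> linarith
  have e2 : orient y z (2 • z - x + (z - y)) < 0 ∧ orient z x (2 • z - x + (z - y)) < 0 := by
    have a1 : orient y z (2 • z - x + (z - y)) = -orient x y z := by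
      simp [orient_eq]; ring
    have a2 : orient z x (2 • z - x + (z - y)) = -orient x y z := by
      simp [orient_eq]; ring
    constructor <;> linarith
  have := IsPreconnected.union (2 • y - z + (y - x)) e1.1 (Or.inl e1.2) (hpre x y)
    (IsPreconnected.union (2 • z - x + (z - y)) e2.1 e2.2 (hpre y z) (hpre z x))
  exact this

/-- The left normal vector of the segment from `x` to `y`. -/
def leftNormal (x y : Plane) : Plane := !₂[-(y - x) 1, (y - x) 0]

theorem orient_leftNormal {x y : Plane} (h : x ≠ y) {ε : ℝ} (hε : 0 < ε) :
    0 < orient x y (midpoint ℝ x y + ε • leftNormal x y) := by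
  have : orient x y (midpoint ℝ x y + ε • leftNormal x y) =
      ε * ((y - x) 0 ^ 2 + (y - x) 1 ^ 2) := by
    rw [midpoint_eq_smul_add]
    simp [orient, cross, leftNormal]; ring
  rw [this]
  exact mul_pos hε (eq_smul_of_cross_eq_zero (sub_ne_zero.2 h.symm) (cross_self _)).1

theorem midpoint_mem_openSegment_plane (x y : Plane) : midpoint ℝ x y ∈ openSegment ℝ x y :=
  ⟨1 / 2, 1 / 2, by norm_num, by norm_num, by norm_num, by rw [midpoint_eq_smul_add]; simp⟩

/-- The midpoint of an edge of a planar drawing lies on no other vertex or edge. -/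
theorem IsPlanarDrawing.midpoint_notMem {G : SimpleGraph V} {f : V → Plane}
    (hf : IsPlanarDrawing G f) {u v x y : V} (huv : G.Adj u v) (hxy : Cell G x y)
    (hs : s(x, y) ≠ s(u, v)) : midpoint ℝ (f u) (f v) ∉ segment ℝ (f x) (f y) := by
  have hmo := midpoint_mem_openSegment_plane (f u) (f v)
  set m := midpoint ℝ (f u) (f v)
  have hne : f u ≠ f v := fun e => huv.ne (hf.injective e)
  have hvert : ∀ w, f w ≠ m := by
    intro w hw
    by_cases hwu : w = u
    · subst hwu
      rw [← hw, left_mem_openSegment_iff] at hmo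
      exact hne hmo
    by_cases hwv : w = v
    · subst hwv
      rw [← hw, right_mem_openSegment_iff] at hmo
      exact hne hmo
    exact hf.vertex_edge u v w huv hwu hwv (hw ▸ openSegment_subset_segment _ _ _ hmo)
  intro hmem
  rcases hxy with rfl | hxy
  · rw [segment_same] at hmem
    exact hvert x hmem.symm
  · rw [← insert_endpoints_openSegment] at hmem
    rcases hmem with h | h | h
    · exact hvert x h.symm
    · exact hvert y h.symm
    · exact disjoint_left.1 (hf.edge_edge x y u v hxy huv hs) h hmo

/-- Just to the left of the midpoint of an edge there is a face with the midpoint on its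
boundary. -/
theorem exists_isFace_left [Finite V] {G : SimpleGraph V} {f : V → Plane}
    (hf : IsPlanarDrawing G f) {u v : V} (huv : G.Adj u v) :
    ∃ F, IsFace G f F ∧ F ⊆ (drawnSet G f)ᶜ ∧ midpoint ℝ (f u) (f v) ∈ frontier F ∧
      ∃ ε₀ : ℝ, 0 < ε₀ ∧ ∀ ε, 0 < ε → ε < ε₀ →
        midpoint ℝ (f u) (f v) + ε • leftNormal (f u) (f v) ∈ F := by
  set m := midpoint ℝ (f u) (f v) with hm
  set n := leftNormal (f u) (f v)
  have hne : f u ≠ f v := fun e => huv.ne (hf.injective e)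
  have hcont : Continuous fun ε : ℝ => m + ε • n := by fun_prop
  have hev : ∀ᶠ ε in 𝓝 (0 : ℝ), ∀ x y, Cell G x y → s(x, y) ≠ s(u, v) →
      m + ε • n ∉ segment ℝ (f x) (f y) := by
    simp only [eventually_all]
    intro x y hxy hs
    have h0 : m + (0 : ℝ) • n ∉ segment ℝ (f x) (f y) := by
      simpa using hf.midpoint_notMem huv hxy hs
    have := eventually_disjoint_segment (s := (0 : ℝ)) hcont hcont
      (continuous_const (y := f x)) (continuous_const (y := f y)) (by simpa [segment_same] using h0)
    simpa [segment_same] using this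
  obtain ⟨ε₀, h0, hε⟩ := Metric.eventually_nhds_iff.1 hev
  have hout : ∀ ε, 0 < ε → ε < ε₀ → m + ε • n ∈ (drawnSet G f)ᶜ := by
    intro ε hε0 hε1
    have hε' := hε (y := ε) (by rw [Real.dist_eq, sub_zero, abs_of_pos hε0]; exact hε1)
    rintro (⟨w, hw⟩ | ⟨x, y, hxy, hmem⟩)
    · refine hε' w w (Or.inl rfl) ?_ (by rw [segment_same]; exact hw)
      intro hs
      rcases Sym2.eq_iff.1 hs with ⟨h1, h2⟩ | ⟨h1, h2⟩
      · exact huv.ne (h1.symm.trans h2)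
      · exact huv.ne (h2.symm.trans h1)
    · by_cases hs : s(x, y) = s(u, v)
      · have hmem' : m + ε • n ∈ segment ℝ (f u) (f v) := by
          rcases Sym2.eq_iff.1 hs with ⟨rfl, rfl⟩ | ⟨rfl, rfl⟩
          · exact hmem
          · rwa [segment_symm]
        obtain ⟨t, -, -, e, -⟩ := orient_of_mem_segment (f u) hmem'
        exact (orient_leftNormal hne hε0).ne' e
      · exact hε' x y (Or.inr hxy) hs hmem
  have hray : IsPreconnected ((fun ε : ℝ => m + ε • n) '' Ioo 0 ε₀) :=
    isPreconnected_Ioo.image _ hcont.continuousOn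
  have hmid : ε₀ / 2 ∈ Ioo 0 ε₀ := ⟨by linarith, by linarith⟩
  have hsub : (fun ε : ℝ => m + ε • n) '' Ioo 0 ε₀ ⊆
      connectedComponentIn (drawnSet G f)ᶜ (m + (ε₀ / 2) • n) := by
    refine hray.subset_connectedComponentIn ⟨_, hmid, rfl⟩ ?_
    rintro _ ⟨ε, hε, rfl⟩
    exact hout ε hε.1 hε.2
  refine ⟨_, ⟨_, hout _ hmid.1 hmid.2, rfl⟩, connectedComponentIn_subset _ _, ⟨?_, fun hi => ?_⟩,
    ε₀, h0, fun ε h1 h2 => hsub ⟨ε, ⟨h1, h2⟩, rfl⟩⟩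
  · have ht : Tendsto (fun ε : ℝ => m + ε • n) (𝓝[>] 0) (𝓝 m) := by
      have := (hcont.tendsto 0).mono_left (nhdsWithin_le_nhds (s := Ioi 0))
      simpa using this
    refine mem_closure_of_tendsto ht ?_
    filter_upwards [Ioo_mem_nhdsGT h0] with ε hε
    exact hsub ⟨ε, hε, rfl⟩
  · exact connectedComponentIn_subset _ _ (interior_subset hi)
      (Or.inr ⟨u, v, huv, midpoint_mem_segment _ _⟩)

/-- A drawing with triangular faces is a triangulation in the combinatorial sense: the inside or
the outside of the triangle that bounds the face to the left of an edge is contained in this face,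
according to the side of the edge on which the third corner lies. -/
theorem IsTriangulated.isTriangulation [Finite V] {G : SimpleGraph V} {f : V → Plane}
    (hf : IsTriangulated G f) : IsTriangulation G f := by
  refine ⟨hf.planar, fun u v huv => ?_⟩
  obtain ⟨F, hF, hFd, hmF, ε₀, h0, hε⟩ := exists_isFace_left hf.planar huv
  set m := midpoint ℝ (f u) (f v) with hm
  set n := leftNormal (f u) (f v)
  have hleft : ∀ ε : ℝ, 0 < ε → 0 < orient (f u) (f v) (m + ε • n) := fun ε =>
    orient_leftNormal fun e => huv.ne (hf.planar.injective e)
  obtain ⟨w, huw, hvw, hfr⟩ : ∃ w, G.Adj v w ∧ G.Adj w u ∧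
      frontier F = triangleBoundary (f u) (f v) (f w) := by
    obtain ⟨x, y, z, hxy, hyz, hzx, hfr⟩ := hf.faces F hF
    change frontier F = triangleBoundary (f x) (f y) (f z) at hfr
    -- the edge through the midpoint is a side of the bounding triangle
    have hside : ∀ x y z, G.Adj x y → G.Adj y z → G.Adj z x →
        frontier F = triangleBoundary (f x) (f y) (f z) → m ∈ segment ℝ (f x) (f y) →
        ∃ w, G.Adj v w ∧ G.Adj w u ∧ frontier F = triangleBoundary (f u) (f v) (f w) := by
      intro x y z hxy hyz hzx hfr hmem
      have hs : s(x, y) = s(u, v) := by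
        by_contra hs
        exact hf.planar.midpoint_notMem huv (Or.inr hxy) hs hmem
      rcases Sym2.eq_iff.1 hs with ⟨rfl, rfl⟩ | ⟨rfl, rfl⟩
      · exact ⟨z, hyz, hzx, hfr⟩
      · exact ⟨z, hzx.symm, hyz.symm, by rw [hfr, triangleBoundary_swap]⟩
    have hmem := hmF
    rw [hfr] at hmem
    rcases hmem with (hmem | hmem) | hmem
    · exact hside x y z hxy hyz hzx hfr hmem
    · exact hside y z x hyz hzx hxy (hfr.trans (triangleBoundary_rotate _ _ _).symm) hmem
    · exact hside z x y hzx hxy hyz (hfr.trans (triangleBoundary_rotate _ _ _)) hmem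
  have hvert : ∀ s, f s ∉ F := fun s hs => hFd hs (Or.inl ⟨s, rfl⟩)
  rcases lt_or_gt_of_ne (hf.planar.orient_ne_zero huv huw hvw) with ho | ho
  · right
    have ho' : 0 < orient (f v) (f u) (f w) := by rw [orient_swap]; linarith
    have hsub := subset_of_disjoint_frontier (t := F) (isPreconnected_outside ho')
      ⟨m + (ε₀ / 2) • n, Or.inl (by
          rw [orient_swap]; linarith [hleft (ε₀ / 2) (by linarith)]),
        hε _ (by linarith) (by linarith)⟩ (by
        rw [hfr, ← triangleBoundary_swap, disjoint_left]
        intro s hs hs'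
        have := orient_nonneg_of_mem_triangleBoundary ho' hs'
        rcases hs with hs | hs | hs <;> linarith [this.1, this.2.1, this.2.2])
    refine ⟨w, huv.symm, hvw.symm, huw.symm, ho', fun s h1 h2 h3 => ?_⟩
    have hns : ¬ (orient (f v) (f u) (f s) < 0 ∨ orient (f u) (f w) (f s) < 0 ∨
        orient (f w) (f v) (f s) < 0) := fun h => hvert s (hsub h)
    push Not at hns
    obtain ⟨n1, n2, n3⟩ := hns
    obtain ⟨k1, k2, k3⟩ := hf.planar.off_triangle huv.symm hvw.symm huw.symm h1 h2 h3
    have ho2 : 0 < orient (f u) (f w) (f v) := by rwa [orient_rotate]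
    have ho3 : 0 < orient (f w) (f v) (f u) := by rwa [orient_rotate]
    exact ⟨lt_of_le_of_ne n1 fun h => k1 (mem_segment_of_orient ho' h.symm n2 n3),
      lt_of_le_of_ne n2 fun h => k2 (mem_segment_of_orient ho2 h.symm n3 n1),
      lt_of_le_of_ne n3 fun h => k3 (mem_segment_of_orient ho3 h.symm n1 n2)⟩
  · left
    -- points close to the midpoint on its left are inside the triangle
    have hin : ∀ᶠ ε in 𝓝[>] (0 : ℝ), InTriangle (f u) (f v) (f w) (m + ε • n) := by
      have hcont : Continuous fun ε : ℝ => m + ε • n := by fun_prop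
      have hm0 : 0 < orient (f v) (f w) m ∧ 0 < orient (f w) (f u) m := by
        have a1 : orient (f v) (f w) m = orient (f u) (f v) (f w) / 2 := by
          rw [hm, midpoint_eq_smul_add]; simp [orient_eq]; ring
        have a2 : orient (f w) (f u) m = orient (f u) (f v) (f w) / 2 := by
          rw [hm, midpoint_eq_smul_add]; simp [orient_eq]; ring
        constructor <;> linarith
      have t1 : Tendsto (fun ε : ℝ => orient (f v) (f w) (m + ε • n)) (𝓝[>] 0)
          (𝓝 (orient (f v) (f w) m)) := by
        have : Continuous fun ε : ℝ => orient (f v) (f w) (m + ε • n) := by fun_prop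
        simpa using (this.tendsto 0).mono_left (nhdsWithin_le_nhds (s := Ioi 0))
      have t2 : Tendsto (fun ε : ℝ => orient (f w) (f u) (m + ε • n)) (𝓝[>] 0)
          (𝓝 (orient (f w) (f u) m)) := by
        have : Continuous fun ε : ℝ => orient (f w) (f u) (m + ε • n) := by fun_prop
        simpa using (this.tendsto 0).mono_left (nhdsWithin_le_nhds (s := Ioi 0))
      filter_upwards [t1.eventually_const_lt hm0.1, t2.eventually_const_lt hm0.2,
        self_mem_nhdsWithin] with ε i1 i2 i3
      exact ⟨hleft ε i3, i1, i2⟩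
    obtain ⟨ε, hε1, hε2⟩ := (hin.and (Ioo_mem_nhdsGT h0)).exists
    have hsub := subset_of_disjoint_frontier (t := F)
      (isPreconnected_inTriangle (f u) (f v) (f w))
      ⟨m + ε • n, hε1, hε ε hε2.1 hε2.2⟩ (by
        rw [hfr, disjoint_left]
        exact fun s hs hs' => not_inTriangle_of_mem_triangleBoundary hs' hs)
    exact ⟨w, huv, huw, hvw, ho, fun s hs => hvert s (hsub hs)⟩

end PlanarMorph

theorem lemma3p1 {V : Type*} [Finite V] (G : SimpleGraph V) (Γ₁ Γ₂ : V → PlanarMorph.Plane)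
    (hG : PlanarMorph.IsTriangulated G Γ₁) (k : ℕ) (M : PlanarMorph.PseudoMorph G Γ₁ Γ₂)
    (hk : M.numSteps = k) (hplanar : M.IsPlanar) (huni : M.IsUnidirectional)
    (hdeg : M.ContractsDegreeLE 5) :
    ∃ Γ : Fin (k + 1) → V → PlanarMorph.Plane, Γ 0 = Γ₁ ∧ Γ (Fin.last k) = Γ₂ ∧
      ∀ i : Fin k, PlanarMorph.IsPlanarStep G (Γ i.castSucc) (Γ i.succ) ∧
        PlanarMorph.IsUnidirectionalStep (Γ i.castSucc) (Γ i.succ) := by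
  subst hk
  exact (M.hasMorph inferInstance hG.isTriangulation hplanar huni).exists_fin
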